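/- Let $d\ge 1$ be a fixed integer and let $\alpha>0$ be a fixed real number. For a partition $\lambda=(\lambda_1\ge\lambda_2\ge\cdots)$, identified with its Young diagram $\{(i,j): i\ge 1,\ 1\le j\le\lambda_i\}$, let $\lambda'$ be the conjugate partition, let $\ell(\lambda)$ be the number of nonzero parts, and put $$c_\lambda(\alpha)=\prod_{(i,j)\in\lambda}\bigl(\alpha(\lambda_i-j)+(\lambda'_j-i)+1\bigr),\qquad c'_\lambda(\alpha)=\prod_{(i,j)\in\lambda}\bigl(\alpha(\lambda_i-j)+(\lambda'_j-i)+\alpha\bigr).$$ For $\beta>0$ let $$Z'_d(\beta)=\int e^{-\frac{d\beta}{2}(x_1^2+\cdots+x_d^2)}\prod_{1\le i<j\le d}(x_i-x_j)^\beta\,dx_1\cdots dx_{d-1},$$ where the integral runs over all $(x_1,\dots,x_{d-1})\in\mathbb{R}^{d-1}$ such that $x_1\ge\cdots\ge x_{d-1}\ge x_d$ with $x_d:=-(x_1+\cdots+x_{d-1})$ (so $Z'_1(\beta)=1$). Then, as $n\to\infty$, $$\sum_{\lambda\vdash n,\ \ell(\lambda)\le d}\frac{n!}{c_\lambda(\alpha)}\,\frac{n!}{c'_\lambda(\alpha)}\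 \sim\ \frac{\Gamma(1/\alpha)^d\,d^{\,2n+d^2/\alpha}}{(2\pi)^{d-1}\,\alpha^{\,2n+\frac{d^2-d}{2\alpha}+\frac{d-1}{2}}\,n^{\frac{d^2+d}{2\alpha}-\frac{d+1}{2}}}\;Z'_d(2/\alpha),$$ where $\sim$ means that the ratio of the two sides tends to $1$. -/

import Mathlib

open scoped BigOperators

/-- Only finitely many Young diagrams have `n` cells. -/
theorem finite_youngDiagram_card_length (n d : ℕ) :
    {μ : YoungDiagram | μ.card = n ∧ μ.colLen 0 ≤ d}.Finite := by
  have hinj : Set.InjOn YoungDiagram.cells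
      {μ : YoungDiagram | μ.card = n ∧ μ.colLen 0 ≤ d} := fun μ _ ν _ h => YoungDiagram.ext h
  refine Set.Finite.of_finite_image (Set.Finite.subset
    (Finset.finite_toSet ((Finset.range n ×ˢ Finset.range n).powerset)) ?_) hinj
  rintro _ ⟨μ, ⟨hμ, -⟩, rfl⟩
  simp only [Finset.coe_powerset, Set.mem_preimage, Set.mem_powerset_iff, Finset.coe_subset]
  rintro ⟨i, j⟩ hij
  have hij' : (i, j) ∈ μ := hij
  have h1 : μ.rowLen i ≤ n := by
    rw [← hμ, YoungDiagram.rowLen_eq_card]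
    exact Finset.card_le_card (Finset.filter_subset _ _)
  have h2 : μ.colLen j ≤ n := by
    rw [← hμ, YoungDiagram.colLen_eq_card]
    exact Finset.card_le_card (Finset.filter_subset _ _)
  have h3 := YoungDiagram.mem_iff_lt_rowLen.1 hij'
  have h4 := YoungDiagram.mem_iff_lt_colLen.1 hij'
  simp only [Finset.mem_product, Finset.mem_range]
  omega

/-- The partitions of `n` of length at most `d`, as Young diagrams. The length (number of
nonzero parts) is the length of the first column. -/
noncomputable def partitionsOfLengthLE (n d : ℕ) : Finset YoungDiagram :=
  (finite_youngDiagram_card_length n d).toFinset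

theorem mem_partitionsOfLengthLE {n d : ℕ} {μ : YoungDiagram} :
    μ ∈ partitionsOfLengthLE n d ↔ μ.card = n ∧ μ.colLen 0 ≤ d := by
  simp [partitionsOfLengthLE]

/-- The arm length `λ_i - j` of a cell. Cells are indexed from `(0, 0)`, so the cell `(i, j)`
in one-based indexing is `s = (i - 1, j - 1)`. -/
def armLength (μ : YoungDiagram) (s : ℕ × ℕ) : ℝ :=
  (μ.rowLen s.1 : ℝ) - ((s.2 : ℝ) + 1)

/-- The leg length `λ'_j - i` of a cell. -/
def legLength (μ : YoungDiagram) (s : ℕ × ℕ) : ℝ :=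
  (μ.colLen s.2 : ℝ) - ((s.1 : ℝ) + 1)

/-- `c_λ(α) = ∏ (α (λ_i - j) + (λ'_j - i) + 1)` over the cells `(i, j)` of `λ`. -/
noncomputable def jackHookLower (α : ℝ) (μ : YoungDiagram) : ℝ :=
  ∏ s ∈ μ.cells, (α * armLength μ s + legLength μ s + 1)

/-- `c'_λ(α) = ∏ (α (λ_i - j) + (λ'_j - i) + α)` over the cells `(i, j)` of `λ`. -/
noncomputable def jackHookUpper (α : ℝ) (μ : YoungDiagram) : ℝ :=
  ∏ s ∈ μ.cells, (α * armLength μ s + legLength μ s + α)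

/-- The set of weakly decreasing vectors in `ℝ^d` with coordinate sum zero. -/
def tracelessChamber (d : ℕ) : Set (Fin d → ℝ) :=
  {x | (∀ i j : Fin d, i ≤ j → x j ≤ x i) ∧ ∑ i, x i = 0}

/-- Completes `(x_1, …, x_{d-1})` by the last coordinate `x_d = -(x_1 + ⋯ + x_{d-1})`. -/
noncomputable def tracelessExtend (d : ℕ) (y : Fin (d - 1) → ℝ) : Fin d → ℝ :=
  fun i => if h : (i : ℕ) < d - 1 then y ⟨i, h⟩ else -∑ k, y k

/-- `Z'_d(β)`: the integral over the chamber of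
`exp (-(d β / 2) ∑ x_i ^ 2) ∏_{i < j} (x_i - x_j) ^ β` with respect to `dx_1 ⋯ dx_{d-1}`. -/
noncomputable def regevIntegral (d : ℕ) (β : ℝ) : ℝ :=
  ∫ y : Fin (d - 1) → ℝ in {y | tracelessExtend d y ∈ tracelessChamber d},
    Real.exp (-((d : ℝ) * β / 2) * ∑ i, (tracelessExtend d y i) ^ 2) *
      ∏ i : Fin d, ∏ j ∈ Finset.Ioi i, (tracelessExtend d y i - tracelessExtend d y j) ^ β

/-! Write θ = 1/α. In row i the leg length is constant on each block of columns λ_{k+1} ≤ j < λ_k,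
so each block of a hook product telescopes to a quotient of Gamma values. Hence both hook products
are products of Γ(λ_i + a) over rows and of Gamma quotients in λ_i - λ_k over pairs
(`YoungDiagram.hook_prod`).

Since Γ(k + a) ~ k! (k + 1)^(a-1), the summand equals an explicit function of n times
`partitionWeight`: squared Poisson weights of mean n/d, powers of (λ_i + 1)/n, powers ((λ_i - λ_j +
1)/√(θn))^(2θ), and corrections tending to 1 (`summand_eq_partitionWeight`). Put λ_i = n/d + √(θn)
x_i. The local limit theorem turns the squared Poisson weights into Gaussians, and the weight
converges to a constant times the integrand of Z'_d(2θ) (`tendsto_partitionWeight`).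

The sum over λ is thus a Riemann sum in d - 1 variables with mesh 1/√(θn). It is written as the
integral of a step function; the bound `exists_partitionWeight_le`, valid for all λ and not only
near the centre, gives an integrable majorant, and dominated convergence applies
(`tendsto_sum_partitionWeight`). Positivity of Z'_d (`regevIntegral_pos`) allows division by the
limit. -/

/-! ### Hook products as Gamma quotients. -/

/-- Telescoping of Γ(x + 1) = x Γ(x). It serves for one block of columns of equal length, with L the
length of the row. -/
theorem prod_Ico_sub_eq_Gamma_div {t : ℝ} (ht : 0 < t) {L a b : ℕ} (hab : b ≤ a) (haL : a ≤ L) :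
    ∏ j ∈ Finset.Ico b a, ((L : ℝ) - (j + 1) + t) =
      Real.Gamma ((L : ℝ) - b + t) / Real.Gamma ((L : ℝ) - a + t) := by
  induction a, hab using Nat.le_induction with
  | base =>
    have : (b : ℝ) ≤ L := by exact_mod_cast haL
    rw [Finset.Ico_self, Finset.prod_empty, div_self (Real.Gamma_pos_of_pos (by linarith)).ne']
  | succ a hab ih =>
    have h : (a : ℝ) + 1 ≤ L := by exact_mod_cast haL
    have hpos : 0 < (L : ℝ) - (a + 1) + t := by linarith
    have hG := Real.Gamma_add_one hpos.ne'
    have e : (L : ℝ) - (a + 1) + t + 1 = L - a + t := by ring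
    rw [e] at hG
    have h0 := (Real.Gamma_pos_of_pos hpos).ne'
    rw [Finset.prod_Ico_succ_top hab, ih (by omega), hG]
    push_cast
    field_simp

theorem YoungDiagram.rowLen_eq_zero_of_colLen_le {μ : YoungDiagram} {d i : ℕ}
    (h : μ.colLen 0 ≤ d) (hi : d ≤ i) : μ.rowLen i = 0 := by
  by_contra h0
  have h1 : (i, 0) ∈ μ := YoungDiagram.mem_iff_lt_rowLen.2 (Nat.pos_of_ne_zero h0)
  have h2 := YoungDiagram.mem_iff_lt_colLen.1 h1
  omega

theorem YoungDiagram.prod_cells {M : Type*} [CommMonoid M] {μ : YoungDiagram} {d : ℕ}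
    (h : μ.colLen 0 ≤ d) (f : ℕ × ℕ → M) :
    ∏ s ∈ μ.cells, f s = ∏ i ∈ Finset.range d, ∏ j ∈ Finset.range (μ.rowLen i), f (i, j) := by
  refine Finset.prod_finset_product _ _ _ fun p => ?_
  rw [YoungDiagram.mem_cells, Finset.mem_range, Finset.mem_range]
  constructor
  · intro hp
    have h1 := YoungDiagram.mem_iff_lt_rowLen.1 hp
    refine ⟨?_, h1⟩
    by_contra h2
    rw [YoungDiagram.rowLen_eq_zero_of_colLen_le h (not_lt.1 h2)] at h1
    omega
  · rintro ⟨-, hp⟩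
    exact YoungDiagram.mem_iff_lt_rowLen.2 hp

theorem YoungDiagram.card_eq_sum_rowLen {μ : YoungDiagram} {d : ℕ} (h : μ.colLen 0 ≤ d) :
    μ.card = ∑ i ∈ Finset.range d, μ.rowLen i := by
  -- The multiplicative formula, used in `Multiplicative ℕ`, yields the additive one.
  have := YoungDiagram.prod_cells h (fun _ => Multiplicative.ofAdd 1)
  simp only [Finset.prod_const, Finset.card_range] at this
  have h2 := congrArg Multiplicative.toAdd this
  simpa [toAdd_prod] using h2

theorem YoungDiagram.colLen_eq_of_rowLen {μ : YoungDiagram} {K j : ℕ} (h1 : μ.rowLen (K + 1) ≤ j)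
    (h2 : j < μ.rowLen K) : μ.colLen j = K + 1 := by
  have h3 := YoungDiagram.mem_iff_lt_colLen.1 (YoungDiagram.mem_iff_lt_rowLen.2 h2)
  by_contra h4
  have h5 : K + 1 < μ.colLen j := by omega
  have h6 := YoungDiagram.mem_iff_lt_rowLen.1 (YoungDiagram.mem_iff_lt_colLen.2 h5)
  omega

/-- The part of the generalized hook product of row `i` in the columns `j ≥ λ_K`. -/
theorem YoungDiagram.hook_row_prod_Ico (μ : YoungDiagram) {α s : ℝ} (hα : 0 < α) (hs : 0 < s)
    {i K : ℕ} (hK : i + 1 ≤ K) :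
    ∏ j ∈ Finset.Ico (μ.rowLen K) (μ.rowLen i),
        (α * armLength μ (i, j) + legLength μ (i, j) + α * s) =
      α ^ (μ.rowLen i - μ.rowLen K) *
        (Real.Gamma ((μ.rowLen i : ℝ) - μ.rowLen K + (s + 1 / α * ((K : ℝ) - i - 1))) /
          Real.Gamma s) *
        ∏ k ∈ Finset.Ioo i K,
          (Real.Gamma ((μ.rowLen i : ℝ) - μ.rowLen k + (s + 1 / α * ((k : ℝ) - i - 1))) /
            Real.Gamma ((μ.rowLen i : ℝ) - μ.rowLen k + (s + 1 / α * ((k : ℝ) - i)))) := by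
  -- On this block every column has length K + 1, so the leg is K - i and each factor is α times λ_i
  -- - (j + 1) + s + (K - i)/α.
  have key : ∀ K, i ≤ K → ∏ j ∈ Finset.Ico (μ.rowLen (K + 1)) (μ.rowLen K),
      (α * armLength μ (i, j) + legLength μ (i, j) + α * s) =
      α ^ (μ.rowLen K - μ.rowLen (K + 1)) *
        (Real.Gamma ((μ.rowLen i : ℝ) - μ.rowLen (K + 1) + (s + 1 / α * ((K : ℝ) - i))) /
        Real.Gamma ((μ.rowLen i : ℝ) - μ.rowLen K + (s + 1 / α * ((K : ℝ) - i)))) := by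
    intro K hiK
    have hc : (0 : ℝ) ≤ (K : ℝ) - i := by
      have : (i : ℝ) ≤ K := by exact_mod_cast hiK
      linarith
    rw [← prod_Ico_sub_eq_Gamma_div (by positivity) (μ.rowLen_anti _ _ (Nat.le_succ K))
      (μ.rowLen_anti _ _ hiK), ← Nat.card_Ico, ← Finset.prod_const, ← Finset.prod_mul_distrib]
    refine Finset.prod_congr rfl fun j hj => ?_
    rw [Finset.mem_Ico] at hj
    rw [armLength, legLength, YoungDiagram.colLen_eq_of_rowLen hj.1 hj.2]
    push_cast
    field_simp
    ring
  induction K, hK using Nat.le_induction with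
  | base =>
    rw [key i le_rfl]
    have : Finset.Ioo i (i + 1) = ∅ := by ext; simp
    rw [this]
    simp
  | succ K hK ih =>
    have hle := μ.rowLen_anti i K (by omega)
    have hle' := μ.rowLen_anti K (K + 1) (by omega)
    have hpos : 0 < Real.Gamma ((μ.rowLen i : ℝ) - μ.rowLen K + (s + 1 / α * ((K : ℝ) - i))) := by
      refine Real.Gamma_pos_of_pos ?_
      have h1 : (μ.rowLen K : ℝ) ≤ μ.rowLen i := by exact_mod_cast hle
      have h2 : (i : ℝ) + 1 ≤ K := by exact_mod_cast hK
      have h3 : (0 : ℝ) ≤ (K : ℝ) - i := by linarith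
      have : 0 ≤ 1 / α * ((K : ℝ) - i) := by positivity
      linarith
    have hI : Finset.Ioo i (K + 1) = insert K (Finset.Ioo i K) := by
      ext; simp; omega
    -- The boundary Gamma value left at stage K pairs with the denominator of the new block and
    -- becomes the factor k = K of the product over `Finset.Ioo`.
    rw [← Finset.prod_Ico_consecutive _ hle' hle, key K (by omega), ih, hI,
      Finset.prod_insert (by simp)]
    have e : μ.rowLen i - μ.rowLen (K + 1) =
        (μ.rowLen K - μ.rowLen (K + 1)) + (μ.rowLen i - μ.rowLen K) := by omega
    have e2 : ((K + 1 : ℕ) : ℝ) - i - 1 = (K : ℝ) - i := by push_cast; ring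
    rw [e, pow_add, e2]
    ring

/-- The row formula at K = d, where λ_d = 0 makes the blocks exhaust the row. The value s = 1/α
gives c_λ and s = 1 gives c'_λ. -/
theorem YoungDiagram.hook_prod (μ : YoungDiagram) {α s : ℝ} (hα : 0 < α) (hs : 0 < s)
    {d : ℕ} (hμ : μ.colLen 0 ≤ d) :
    ∏ c ∈ μ.cells, (α * armLength μ c + legLength μ c + α * s) =
      α ^ μ.card * ∏ i : Fin d,
        ((Real.Gamma ((μ.rowLen i : ℝ) + (s + 1 / α * ((d : ℝ) - i - 1))) / Real.Gamma s) *
        ∏ k ∈ Finset.Ioi i,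
          (Real.Gamma (((μ.rowLen i - μ.rowLen k : ℕ) : ℝ) + (s + 1 / α * ((k : ℝ) - i - 1))) /
            Real.Gamma (((μ.rowLen i - μ.rowLen k : ℕ) : ℝ) + (s + 1 / α * ((k : ℝ) - i))))) := by
  rw [YoungDiagram.prod_cells hμ, YoungDiagram.card_eq_sum_rowLen hμ, ← Finset.prod_pow_eq_pow_sum,
    Finset.prod_range, Finset.prod_range, ← Finset.prod_mul_distrib]
  refine Finset.prod_congr rfl fun i _ => ?_
  have h := μ.hook_row_prod_Ico hα hs (i := i) (K := d) i.2
  rw [YoungDiagram.rowLen_eq_zero_of_colLen_le hμ le_rfl, Nat.Ico_zero_eq_range] at h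
  rw [h, ← Fin.map_valEmbedding_Ioi, Finset.prod_map, mul_assoc]
  simp only [Nat.sub_zero, Nat.cast_zero, sub_zero, Fin.valEmbedding_apply]
  congr 2
  refine Finset.prod_congr rfl fun k hk => ?_
  rw [Nat.cast_sub (μ.rowLen_anti _ _ (Fin.le_def.1 (Finset.mem_Ioi.1 hk).le))]

/-! ### Partitions as decreasing integer vectors. -/

/-- The weakly decreasing vectors of `d` natural numbers with sum `n`. -/
def antitoneCompositions (n d : ℕ) : Finset (Fin d → ℕ) :=
  open Classical in (Finset.piAntidiag Finset.univ n).filter Antitone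

theorem mem_antitoneCompositions {n d : ℕ} {v : Fin d → ℕ} :
    v ∈ antitoneCompositions n d ↔ ∑ i, v i = n ∧ Antitone v := by
  simp [antitoneCompositions]

/-- The Young diagram with prescribed row lengths. -/
def YoungDiagram.ofAntitone {d : ℕ} (v : Fin d → ℕ) (hv : Antitone v) : YoungDiagram where
  cells := (Finset.univ : Finset (Fin d)).biUnion
    fun i => (Finset.range (v i)).map ⟨fun j => ((i : ℕ), j), fun _ _ h => (Prod.ext_iff.1 h).2⟩
  isLowerSet := by
    rintro ⟨i, j⟩ ⟨i', j'⟩ hle h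
    simp only [Finset.coe_biUnion, Finset.coe_univ, Set.mem_iUnion, Finset.coe_map,
      Set.mem_image, Finset.mem_coe, Finset.mem_range,
      Set.mem_univ, exists_true_left] at h ⊢
    obtain ⟨k, l, hl, h⟩ := h
    cases h
    have h1 : i' ≤ k := hle.1
    have h2 : j' ≤ _ := hle.2
    refine ⟨⟨i', by omega⟩, j', ?_, rfl⟩
    have := hv (show (⟨i', by omega⟩ : Fin d) ≤ k from h1)
    omega

theorem YoungDiagram.mem_ofAntitone {d : ℕ} {v : Fin d → ℕ} {hv : Antitone v} {i j : ℕ} :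
    (i, j) ∈ YoungDiagram.ofAntitone v hv ↔ ∃ h : i < d, j < v ⟨i, h⟩ := by
  rw [← YoungDiagram.mem_cells]
  simp only [YoungDiagram.ofAntitone, Finset.mem_biUnion, Finset.mem_univ, true_and,
    Finset.mem_map, Finset.mem_range]
  constructor
  · rintro ⟨k, l, hl, h⟩
    cases h
    exact ⟨k.2, hl⟩
  · rintro ⟨h, hl⟩
    exact ⟨⟨i, h⟩, j, hl, rfl⟩

theorem YoungDiagram.rowLen_ofAntitone {d : ℕ} {v : Fin d → ℕ} {hv : Antitone v} (i : Fin d) :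
    (YoungDiagram.ofAntitone v hv).rowLen i = v i := by
  refine le_antisymm ?_ ?_ <;> by_contra! h
  · have := YoungDiagram.mem_iff_lt_rowLen.2 h
    rw [YoungDiagram.mem_ofAntitone] at this
    obtain ⟨_, h⟩ := this
    exact lt_irrefl _ h
  · have : ((i : ℕ), (YoungDiagram.ofAntitone v hv).rowLen i) ∈ YoungDiagram.ofAntitone v hv :=
      YoungDiagram.mem_ofAntitone.2 ⟨i.2, h⟩
    exact lt_irrefl _ (YoungDiagram.mem_iff_lt_rowLen.1 this)

theorem YoungDiagram.colLen_ofAntitone_le {d : ℕ} {v : Fin d → ℕ} {hv : Antitone v} :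
    (YoungDiagram.ofAntitone v hv).colLen 0 ≤ d := by
  by_contra! h
  obtain ⟨h, -⟩ := YoungDiagram.mem_ofAntitone.1 (YoungDiagram.mem_iff_lt_colLen.2 h)
  exact lt_irrefl _ h

theorem sum_partitionsOfLengthLE {n d : ℕ} (f : YoungDiagram → ℝ) (g : (Fin d → ℕ) → ℝ)
    (h : ∀ μ ∈ partitionsOfLengthLE n d, f μ = g fun i => μ.rowLen i) :
    ∑ μ ∈ partitionsOfLengthLE n d, f μ = ∑ v ∈ antitoneCompositions n d, g v := by
  refine Finset.sum_bij (fun μ _ => fun i : Fin d => μ.rowLen i) ?_ ?_ ?_ h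
  · intro μ hμ
    rw [mem_partitionsOfLengthLE] at hμ
    rw [mem_antitoneCompositions, ← hμ.1, YoungDiagram.card_eq_sum_rowLen hμ.2, Finset.sum_range]
    exact ⟨rfl, fun i j hij => μ.rowLen_anti _ _ hij⟩
  · intro μ hμ ν hν hh
    rw [mem_partitionsOfLengthLE] at hμ hν
    have hr : ∀ i, μ.rowLen i = ν.rowLen i := by
      intro i
      by_cases hi : i < d
      · exact congrFun hh ⟨i, hi⟩
      · rw [YoungDiagram.rowLen_eq_zero_of_colLen_le hμ.2 (not_lt.1 hi),
          YoungDiagram.rowLen_eq_zero_of_colLen_le hν.2 (not_lt.1 hi)]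
    refine YoungDiagram.ext ?_
    ext ⟨i, j⟩
    rw [YoungDiagram.mem_cells, YoungDiagram.mem_cells, YoungDiagram.mem_iff_lt_rowLen,
      YoungDiagram.mem_iff_lt_rowLen, hr]
  · intro v hv
    rw [mem_antitoneCompositions] at hv
    refine ⟨YoungDiagram.ofAntitone v hv.2, ?_, funext fun i => YoungDiagram.rowLen_ofAntitone i⟩
    rw [mem_partitionsOfLengthLE]
    refine ⟨?_, YoungDiagram.colLen_ofAntitone_le⟩
    rw [YoungDiagram.card_eq_sum_rowLen YoungDiagram.colLen_ofAntitone_le, Finset.sum_range]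
    refine Eq.trans ?_ hv.1
    exact Finset.sum_congr rfl fun i _ => YoungDiagram.rowLen_ofAntitone i

/-! ### Gamma asymptotics at integers. -/

/-- The quotient of `Γ(k + a)` by its leading asymptotics `k! (k + 1) ^ (a - 1)`. -/
noncomputable def gammaQuot (a : ℝ) (k : ℕ) : ℝ :=
  Real.Gamma (k + a) / (k.factorial * ((k : ℝ) + 1) ^ (a - 1))

theorem gammaQuot_pos {a : ℝ} (ha : 0 < a) (k : ℕ) : 0 < gammaQuot a k := by
  have : 0 < Real.Gamma (k + a) := Real.Gamma_pos_of_pos (by positivity)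
  unfold gammaQuot
  positivity

theorem Gamma_eq_gammaQuot_mul (a : ℝ) (k : ℕ) :
    Real.Gamma (k + a) = gammaQuot a k * (k.factorial * ((k : ℝ) + 1) ^ (a - 1)) := by
  unfold gammaQuot
  have : (0 : ℝ) < k.factorial * ((k : ℝ) + 1) ^ (a - 1) := by positivity
  field_simp

theorem prod_range_add_eq_Gamma_div {a : ℝ} (ha : 0 < a) (n : ℕ) :
    ∏ j ∈ Finset.range n, (a + j) = Real.Gamma (n + a) / Real.Gamma a := by
  have h0 := (Real.Gamma_pos_of_pos ha).ne'
  induction n with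
  | zero => simp [h0]
  | succ n ih =>
    have hpos : 0 < (n : ℝ) + a := by positivity
    rw [Finset.prod_range_succ, ih]
    push_cast
    rw [add_right_comm, Real.Gamma_add_one hpos.ne']
    ring

/-- Euler's limit for Γ(a): `gammaQuot a (n + 1)` is Γ(a)/`Real.GammaSeq a n` times elementary
factors tending to 1. The base k + 1 instead of k keeps the quotient positive at k = 0, which covers
empty and equal rows. -/
theorem tendsto_gammaQuot {a : ℝ} (ha : 0 < a) :
    Filter.Tendsto (gammaQuot a) Filter.atTop (nhds 1) := by
  rw [← Filter.tendsto_add_atTop_iff_nat 1]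
  have hG := Real.Gamma_pos_of_pos ha
  have h1 : Filter.Tendsto (fun n : ℕ => (n : ℝ) / (n + 2)) Filter.atTop (nhds 1) := by
    exact tendsto_natCast_div_add_atTop (2 : ℝ)
  have h2 : Filter.Tendsto (fun n : ℕ => (n : ℝ) / (n + 1)) Filter.atTop (nhds 1) :=
    tendsto_natCast_div_add_atTop (1 : ℝ)
  have h3 : Filter.Tendsto (fun n : ℕ => Real.Gamma a / Real.GammaSeq a n *
      (((n : ℝ) / (n + 2)) ^ (a - 1) * ((n : ℝ) / (n + 1)))) Filter.atTop
      (nhds (Real.Gamma a / Real.Gamma a * ((1 : ℝ) ^ (a - 1) * 1))) :=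
    (tendsto_const_nhds.div (Real.GammaSeq_tendsto_Gamma a) hG.ne').mul
      ((h1.rpow_const (Or.inl one_ne_zero)).mul h2)
  rw [div_self hG.ne', Real.one_rpow, mul_one, mul_one] at h3
  refine h3.congr' ?_
  filter_upwards [Filter.eventually_gt_atTop 0] with n hn
  have hn' : (0 : ℝ) < n := by exact_mod_cast hn
  have hp : 0 < Real.Gamma (((n + 1 : ℕ) : ℝ) + a) := Real.Gamma_pos_of_pos (by positivity)
  rw [Real.GammaSeq, prod_range_add_eq_Gamma_div ha, gammaQuot, Real.div_rpow hn'.le (by positivity),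
    Real.rpow_sub_one hn'.ne', Nat.factorial_succ]
  have e : ((n + 1 : ℕ) : ℝ) + 1 = n + 2 := by push_cast; ring
  rw [e]
  push_cast at hp ⊢
  have h5 : (0 : ℝ) < ((n : ℝ) + 2) ^ (a - 1) := by positivity
  have h6 : (0 : ℝ) < (n : ℝ) ^ a := by positivity
  field_simp

theorem exists_pos_bounds_of_tendsto {u : ℕ → ℝ} {l : ℝ} (hl : 0 < l) (hu : ∀ k, 0 < u k)
    (h : Filter.Tendsto u Filter.atTop (nhds l)) :
    ∃ C, 0 < C ∧ ∀ k, u k ≤ C ∧ (u k)⁻¹ ≤ C := by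
  obtain ⟨A, hA⟩ := h.bddAbove_range
  obtain ⟨B, hB⟩ := (h.inv₀ hl.ne').bddAbove_range
  refine ⟨max A B, ?_, fun k => ⟨?_, ?_⟩⟩
  · exact lt_of_lt_of_le (hu 0) ((hA ⟨0, rfl⟩).trans (le_max_left _ _))
  · exact (hA ⟨k, rfl⟩).trans (le_max_left _ _)
  · exact (hB ⟨k, rfl⟩).trans (le_max_right _ _)

/-! ### Poisson weights: local limit and global bounds. -/

/-- The rate function of the Poisson law to second order; its quadratic term produces the Gaussian.
If E is the error of log(1 + δ) after two terms, the difference is (1 + δ)E - δ³/2. -/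
theorem abs_mul_log_sub_le {δ : ℝ} (hδ : |δ| ≤ 1 / 2) :
    |(1 + δ) * Real.log (1 + δ) - δ - δ ^ 2 / 2| ≤ 4 * |δ| ^ 3 := by
  have h1 : |-δ| < 1 := by rw [abs_neg]; linarith
  have h := Real.abs_log_sub_add_sum_range_le h1 2
  rw [abs_neg] at h
  simp only [Finset.sum_range_succ, Finset.sum_range_zero, sub_neg_eq_add] at h
  have h2 : |δ| ^ (2 + 1) / (1 - |δ|) ≤ 2 * |δ| ^ 3 := by
    rw [div_le_iff₀ (by linarith)]
    have : 0 ≤ |δ| ^ 3 := by positivity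
    norm_num
    nlinarith
  set E := Real.log (1 + δ) - δ + δ ^ 2 / 2 with hE
  have h3 : |E| ≤ 2 * |δ| ^ 3 := by
    refine le_trans (le_of_eq ?_) (h.trans h2)
    congr 1
    rw [hE]
    norm_num
    ring
  have e : (1 + δ) * Real.log (1 + δ) - δ - δ ^ 2 / 2 = (1 + δ) * E - δ ^ 3 / 2 := by
    rw [hE]; ring
  rw [e]
  have h4 : |1 + δ| ≤ 3 / 2 := by
    rw [abs_le] at hδ ⊢
    constructor <;> linarith
  calc |(1 + δ) * E - δ ^ 3 / 2| ≤ |(1 + δ) * E| + |δ ^ 3 / 2| := abs_sub _ _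
    _ = |1 + δ| * |E| + |δ| ^ 3 / 2 := by rw [abs_mul, abs_div, abs_pow]; norm_num
    _ ≤ 3 / 2 * (2 * |δ| ^ 3) + |δ| ^ 3 / 2 := by gcongr
    _ ≤ 4 * |δ| ^ 3 := by
      have : 0 ≤ |δ| ^ 3 := by positivity
      linarith

/-- The Poisson weight of mean `n / d`, scaled by `√n`. -/
noncomputable def poissonWeight (d : ℝ) (n k : ℕ) : ℝ :=
  √(n : ℝ) * (Real.exp (-(n / d)) * (n / d) ^ k / k.factorial)

theorem poissonWeight_nonneg {d : ℝ} (hd : 0 < d) (n k : ℕ) : 0 ≤ poissonWeight d n k := by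
  unfold poissonWeight; positivity

/-- Separates Stirling's factor (k/e)^k from the exponential of the rate function. -/
theorem exp_neg_mul_pow_eq {m : ℝ} (hm : 0 < m) {k : ℕ} (hk : 0 < k) :
    Real.exp (-m) * m ^ k =
      (k / Real.exp 1) ^ k * Real.exp (-(k * Real.log (k / m)) + k - m) := by
  have hk' : (0 : ℝ) < k := by exact_mod_cast hk
  have h1 : m ^ k = Real.exp (k * Real.log m) := by
    rw [← Real.rpow_natCast, Real.rpow_def_of_pos hm, mul_comm]
  have h2 : ((k : ℝ) / Real.exp 1) ^ k = Real.exp (k * (Real.log k - 1)) := by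
    rw [← Real.rpow_natCast, Real.rpow_def_of_pos (by positivity), mul_comm,
      Real.log_div hk'.ne' (Real.exp_pos 1).ne', Real.log_exp]
  rw [h1, h2, ← Real.exp_add, ← Real.exp_add, Real.log_div hk'.ne' hm.ne']
  congr 1
  ring

/-- Local limit theorem. With k = (n/d)(1 + δ) one has (n/d)δ² = dθξ² exactly, so the quadratic term
converges, while the cubic error is |δ| times a bounded quantity. -/
theorem tendsto_poissonWeight {d θ x : ℝ} (hd : 0 < d) (hθ : 0 < θ) {k : ℕ → ℕ}
    (hk : Filter.Tendsto (fun n : ℕ => ((k n : ℝ) - n / d) / √(θ * n)) Filter.atTop (nhds x)) :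
    Filter.Tendsto (fun n : ℕ => (k n : ℝ) / n) Filter.atTop (nhds (1 / d)) ∧
    Filter.Tendsto (fun n => poissonWeight d n (k n)) Filter.atTop
      (nhds (√(d / (2 * Real.pi)) * Real.exp (-(d * θ * x ^ 2 / 2)))) := by
  set ξ : ℕ → ℝ := fun n : ℕ => ((k n : ℝ) - n / d) / √(θ * n) with hξ
  have hs : Filter.Tendsto (fun n : ℕ => √(θ / n)) Filter.atTop (nhds 0) := by
    have := (tendsto_const_div_atTop_nhds_zero_nat θ).sqrt
    rwa [Real.sqrt_zero] at this
  have hkn : ∀ n : ℕ, 0 < n → (k n : ℝ) / n = 1 / d + ξ n * √(θ / n) := by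
    intro n hn
    have hn' : (0 : ℝ) < n := by exact_mod_cast hn
    have e : √(θ / n) = √(θ * n) / n := by
      rw [eq_div_iff hn'.ne', ← Real.sqrt_sq hn'.le, ← Real.sqrt_mul (by positivity),
        Real.sqrt_sq hn'.le]
      congr 1
      field_simp
    have hr : 0 < √(θ * n) := Real.sqrt_pos.2 (by positivity)
    rw [e, hξ]
    field_simp
    ring
  have hlim1 : Filter.Tendsto (fun n : ℕ => (k n : ℝ) / n) Filter.atTop (nhds (1 / d)) := by
    have h1 : Filter.Tendsto (fun n : ℕ => 1 / d + ξ n * √(θ / n)) Filter.atTop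
        (nhds (1 / d + x * 0)) := tendsto_const_nhds.add (hk.mul hs)
    rw [mul_zero, add_zero] at h1
    refine h1.congr' ?_
    filter_upwards [Filter.eventually_gt_atTop 0] with n hn
    exact (hkn n hn).symm
  refine ⟨hlim1, ?_⟩
  have hd' : 0 < 1 / d := by positivity
  have hktop : Filter.Tendsto k Filter.atTop Filter.atTop := by
    rw [← tendsto_natCast_atTop_iff (R := ℝ)]
    have := hlim1.pos_mul_atTop hd' (tendsto_natCast_atTop_atTop (R := ℝ))
    refine this.congr' ?_
    filter_upwards [Filter.eventually_gt_atTop 0] with n hn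
    have hn' : (0 : ℝ) < n := by exact_mod_cast hn
    field_simp
  set δ : ℕ → ℝ := fun n => d * (ξ n * √(θ / n)) with hδdef
  have hδ : Filter.Tendsto δ Filter.atTop (nhds 0) := by
    have : Filter.Tendsto δ Filter.atTop (nhds (d * (x * 0))) :=
      tendsto_const_nhds.mul (hk.mul hs)
    rwa [mul_zero, mul_zero] at this
  have hδ2 : ∀ n : ℕ, 0 < n → (n : ℝ) / d * δ n ^ 2 = d * θ * ξ n ^ 2 := by
    intro n hn
    have hn' : (0 : ℝ) < n := by exact_mod_cast hn
    have : √(θ / n) ^ 2 = θ / n := Real.sq_sqrt (by positivity)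
    rw [hδdef]
    simp only [mul_pow, this]
    field_simp
  have hsq : Filter.Tendsto (fun n => d * θ * ξ n ^ 2) Filter.atTop (nhds (d * θ * x ^ 2)) :=
    tendsto_const_nhds.mul (hk.pow 2)
  have hdelta : ∀ᶠ n in Filter.atTop, |δ n| ≤ 1 / 2 := by
    have := hδ.abs
    rw [abs_zero] at this
    exact this.eventually_le_const (by norm_num)
  have hphi : Filter.Tendsto
      (fun n : ℕ => (n : ℝ) / d * ((1 + δ n) * Real.log (1 + δ n) - δ n)) Filter.atTop
      (nhds (d * θ * x ^ 2 / 2)) := by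
    have hdiff : Filter.Tendsto (fun n : ℕ => (n : ℝ) / d *
        ((1 + δ n) * Real.log (1 + δ n) - δ n - δ n ^ 2 / 2)) Filter.atTop (nhds 0) := by
      have hb : Filter.Tendsto (fun n => 4 * |δ n| * (d * θ * ξ n ^ 2)) Filter.atTop
          (nhds (4 * |0| * (d * θ * x ^ 2))) := (tendsto_const_nhds.mul hδ.abs).mul hsq
      rw [abs_zero, mul_zero, zero_mul] at hb
      refine squeeze_zero_norm' ?_ hb
      filter_upwards [hdelta, Filter.eventually_gt_atTop 0] with n hn h0
      rw [Real.norm_eq_abs, abs_mul, abs_of_nonneg (by positivity : (0 : ℝ) ≤ (n : ℝ) / d),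
        ← hδ2 n h0]
      calc (n : ℝ) / d * |(1 + δ n) * Real.log (1 + δ n) - δ n - δ n ^ 2 / 2|
          ≤ (n : ℝ) / d * (4 * |δ n| ^ 3) := by gcongr; exact abs_mul_log_sub_le hn
        _ = 4 * |δ n| * ((n : ℝ) / d * |δ n| ^ 2) := by ring
        _ = _ := by rw [sq_abs]
    have := hdiff.add (hsq.div_const 2)
    rw [zero_add] at this
    refine this.congr' ?_
    filter_upwards [Filter.eventually_gt_atTop 0] with n h0
    rw [← hδ2 n h0]
    ring
  have hstir := Stirling.tendsto_stirlingSeq_sqrt_pi.comp hktop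
  have hpi : √Real.pi ≠ 0 := (Real.sqrt_pos.2 Real.pi_pos).ne'
  have hmain : Filter.Tendsto (fun n => √(((k n : ℝ) / n)⁻¹ / 2) / Stirling.stirlingSeq (k n) *
      Real.exp (-((n : ℝ) / d * ((1 + δ n) * Real.log (1 + δ n) - δ n)))) Filter.atTop
      (nhds (√((1 / d)⁻¹ / 2) / √Real.pi * Real.exp (-(d * θ * x ^ 2 / 2)))) :=
    ((((hlim1.inv₀ hd'.ne').div_const 2).sqrt).div hstir hpi).mul
      ((Real.continuous_exp.tendsto _).comp hphi.neg)
  have e : √((1 / d)⁻¹ / 2) / √Real.pi = √(d / (2 * Real.pi)) := by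
    rw [← Real.sqrt_div' _ Real.pi_pos.le]
    congr 1
    field_simp
  rw [e] at hmain
  refine hmain.congr' ?_
  filter_upwards [Filter.eventually_gt_atTop 0, hktop.eventually_gt_atTop 0] with n h0 hk0
  have hn' : (0 : ℝ) < n := by exact_mod_cast h0
  have hk' : (0 : ℝ) < k n := by exact_mod_cast hk0
  have e1 : 1 + δ n = k n / (n / d) := by
    have := hkn n h0
    have h2 : ξ n * √(θ / n) = (k n : ℝ) / n - 1 / d := by linarith
    rw [hδdef]
    simp only [h2]
    field_simp
    ring
  have e2 : -((n : ℝ) / d * ((1 + δ n) * Real.log (1 + δ n) - δ n)) =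
      -(k n * Real.log (k n / (n / d))) + k n - n / d := by
    have h3 : δ n = k n / (n / d) - 1 := by linarith
    rw [e1, h3]
    field_simp
    ring
  rw [e2, poissonWeight, exp_neg_mul_pow_eq (by positivity) hk0, Stirling.stirlingSeq]
  -- Splits √n so that √(2k) completes `Stirling.stirlingSeq`.
  have e3 : √(((k n : ℝ) / n)⁻¹ / 2) * √(2 * k n) = √(n : ℝ) := by
    rw [← Real.sqrt_mul (by positivity)]
    congr 1
    field_simp
  have h5 : (0 : ℝ) < (k n).factorial := by positivity
  rw [← e3]
  have h6 : 0 < √(2 * (k n : ℝ)) := Real.sqrt_pos.2 (by positivity)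
  field_simp

/-- Stirling's lower bound for k! together with k log(k/m) - k + m ≥ (√k - √m)² ≥ (k - m)²/(4n). The
first inequality is log(a/b) ≥ 1 - b/a at a = √k, b = √m; the second uses (√k + √m)² ≤ 4n. -/
theorem poissonWeight_le {d : ℝ} (hd : 1 ≤ d) {n k : ℕ} (hn : 0 < n) (hk : k ≤ n) :
    poissonWeight d n k ≤ √((n : ℝ) / (k + 1)) * Real.exp (-(((k : ℝ) - n / d) ^ 2 / (4 * n))) := by
  have hn' : (0 : ℝ) < n := by exact_mod_cast hn
  have hk' : (k : ℝ) ≤ n := by exact_mod_cast hk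
  set m : ℝ := n / d with hm
  have hm0 : 0 < m := by positivity
  have hmn : m ≤ n := div_le_self hn'.le hd
  have hfac : √((k : ℝ) + 1) * (k / Real.exp 1) ^ k ≤ k.factorial := by
    rcases Nat.eq_zero_or_pos k with rfl | h0
    · simp
    · refine le_trans ?_ (Stirling.le_factorial_stirling k)
      have h1 : (1 : ℝ) ≤ k := by exact_mod_cast h0
      gcongr
      nlinarith [Real.pi_gt_three]
  have hexp : Real.exp (-m) * m ^ k ≤
      (k / Real.exp 1) ^ k * Real.exp (-(((k : ℝ) - m) ^ 2 / (4 * n))) := by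
    rcases Nat.eq_zero_or_pos k with rfl | h0
    · simp only [pow_zero, mul_one, one_mul, Nat.cast_zero, zero_sub, neg_sq]
      rw [Real.exp_le_exp, neg_le_neg_iff, div_le_iff₀ (by positivity)]
      nlinarith
    · have h1 : (0 : ℝ) < k := by exact_mod_cast h0
      rw [exp_neg_mul_pow_eq hm0 h0]
      refine mul_le_mul_of_nonneg_left (Real.exp_le_exp.2 ?_) (by positivity)
      set a := √(k : ℝ) with ha
      set b := √m with hb
      have ha2 : a ^ 2 = k := Real.sq_sqrt h1.le
      have hb2 : b ^ 2 = m := Real.sq_sqrt hm0.le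
      have ha0 : 0 < a := Real.sqrt_pos.2 h1
      have hb0 : 0 < b := Real.sqrt_pos.2 hm0
      have hlog : 2 * a ^ 2 - 2 * a * b ≤ k * Real.log (k / m) := by
        have h2 := Real.one_sub_inv_le_log_of_pos (div_pos ha0 hb0)
        have h3 : Real.log (k / m) = 2 * Real.log (a / b) := by
          rw [← ha2, ← hb2, ← div_pow, Real.log_pow]
          norm_num
        rw [h3, ← ha2]
        have h4 : a ^ 2 * (1 - (a / b)⁻¹) = a ^ 2 - a * b := by
          field_simp
        nlinarith [mul_le_mul_of_nonneg_left h2 (sq_nonneg a)]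
      have hq : ((k : ℝ) - m) ^ 2 / (4 * n) ≤ (a - b) ^ 2 := by
        rw [div_le_iff₀ (by positivity)]
        have h5 : (a + b) ^ 2 ≤ 4 * n := by nlinarith [sq_nonneg (a - b)]
        have h6 : ((k : ℝ) - m) ^ 2 = (a - b) ^ 2 * (a + b) ^ 2 := by
          rw [← ha2, ← hb2]; ring
        rw [h6]
        gcongr
      nlinarith
  have hk1 : 0 < √((k : ℝ) + 1) := Real.sqrt_pos.2 (by positivity)
  rw [poissonWeight, Real.sqrt_div hn'.le, div_mul_eq_mul_div, mul_div_assoc √(n : ℝ)]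
  refine mul_le_mul_of_nonneg_left ?_ (Real.sqrt_nonneg _)
  rw [div_le_div_iff₀ (by positivity) hk1]
  calc Real.exp (-m) * m ^ k * √((k : ℝ) + 1)
      ≤ (k / Real.exp 1) ^ k * Real.exp (-(((k : ℝ) - m) ^ 2 / (4 * n))) * √((k : ℝ) + 1) := by
        gcongr
    _ = Real.exp (-(((k : ℝ) - m) ^ 2 / (4 * n))) * (√((k : ℝ) + 1) * (k / Real.exp 1) ^ k) := by
        ring
    _ ≤ _ := by gcongr

theorem exists_rpow_mul_exp_neg_sq_le (A : ℝ) {c : ℝ} (hc : 0 < c) :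
    ∃ C, 0 ≤ C ∧ ∀ t : ℝ, 0 ≤ t → (1 + t) ^ A * Real.exp (-(c * t ^ 2)) ≤ C := by
  obtain ⟨N, hN⟩ := exists_nat_ge A
  refine ⟨N.factorial * Real.exp (1 + 1 / (4 * c)), by positivity, fun t ht => ?_⟩
  have h1 : (1 + t) ^ A ≤ (1 + t) ^ N := by
    rw [← Real.rpow_natCast]
    exact Real.rpow_le_rpow_of_exponent_le (by linarith) hN
  have h2 := Real.pow_div_factorial_le_exp (1 + t) (by linarith) N
  rw [div_le_iff₀ (by positivity)] at h2
  have h3 : 1 + t - c * t ^ 2 ≤ 1 + 1 / (4 * c) := by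
    have : 1 / (4 * c) - t + c * t ^ 2 = c * (t - 1 / (2 * c)) ^ 2 := by
      field_simp
      ring
    have h4 : 0 ≤ c * (t - 1 / (2 * c)) ^ 2 := by positivity
    linarith
  calc (1 + t) ^ A * Real.exp (-(c * t ^ 2))
      ≤ (Real.exp (1 + t) * N.factorial) * Real.exp (-(c * t ^ 2)) := by
        gcongr
        exact h1.trans h2
    _ = N.factorial * Real.exp (1 + t - c * t ^ 2) := by
        rw [sub_eq_add_neg, Real.exp_add (1 + t)]; ring
    _ ≤ _ := by gcongr

theorem rpow_le_rpow_abs {t B : ℝ} (e : ℝ) (ht : 0 < t) (h1 : t ≤ B) (h2 : t⁻¹ ≤ B) :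
    t ^ e ≤ B ^ |e| := by
  rcases le_total 0 e with h | h
  · rw [abs_of_nonneg h]
    exact Real.rpow_le_rpow ht.le h1 h
  · rw [abs_of_nonpos h, ← inv_inv t, Real.inv_rpow (by positivity), ← Real.rpow_neg (by positivity)]
    exact Real.rpow_le_rpow (by positivity) h2 (by linarith)

/-- A power of n/(k + 1) is large only when k is far below n/d. Then |x| is of order √n, so n/(k +
1) is at most a constant times (1 + |x|)², which the Gaussian absorbs. -/
theorem exists_poissonWeight_sq_mul_le {d θ : ℝ} (hd : 1 ≤ d) (hθ : 0 < θ) (e M : ℝ) :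
    ∃ C, 0 ≤ C ∧ ∀ n k : ℕ, 0 < n → k ≤ n →
      poissonWeight d n k ^ 2 * (((k : ℝ) + 1) / n) ^ (-e) *
        (1 + |((k : ℝ) - n / d) / √(θ * n)|) ^ M ≤ C := by
  have hd0 : 0 < d := by linarith
  -- The term 2d bounds n/(k + 1) when k + 1 ≥ n/(2d). Otherwise |k - n/d| ≥ n/(2d), and n ≤ 4d²θx².
  set K : ℝ := 2 * d + 4 * d ^ 2 * θ with hK
  obtain ⟨C, hC0, hC⟩ := exists_rpow_mul_exp_neg_sq_le (2 + 2 * |e| + M) (half_pos hθ)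
  refine ⟨(2 + K) ^ (1 + |e|) * C, by positivity, fun n k hn hk => ?_⟩
  have hn' : (0 : ℝ) < n := by exact_mod_cast hn
  have hk' : (k : ℝ) ≤ n := by exact_mod_cast hk
  have h1n : (1 : ℝ) ≤ n := by exact_mod_cast hn
  set x : ℝ := ((k : ℝ) - n / d) / √(θ * n) with hx
  have hx2 : x ^ 2 = ((k : ℝ) - n / d) ^ 2 / (θ * n) := by
    rw [hx, div_pow, Real.sq_sqrt (by positivity)]
  set t : ℝ := (n : ℝ) / (k + 1) with ht
  have ht0 : 0 < t := by positivity
  set B : ℝ := (2 + K) * (1 + |x|) ^ 2 with hB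
  have hax : 0 ≤ |x| := abs_nonneg x
  have hK0 : 0 < K := by positivity
  have hone : (1 : ℝ) ≤ (1 + |x|) ^ 2 := by nlinarith
  have htB : t ≤ B := by
    rcases le_total ((n : ℝ) / (2 * d)) (k + 1) with h | h
    · have h1 : t ≤ 2 * d := by
        rw [ht, div_le_iff₀ (by positivity)]
        rw [div_le_iff₀ (by positivity)] at h
        linarith
      have h2 : 2 * d ≤ 2 + K := by
        have : 0 ≤ 4 * d ^ 2 * θ := by positivity
        linarith
      nlinarith
    · have h1 : t ≤ n := div_le_self hn'.le (by linarith [(Nat.cast_nonneg k : (0 : ℝ) ≤ k)])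
      have h2 : (n : ℝ) / (2 * d) ≤ n / d - k := by
        have : (n : ℝ) / d = n / (2 * d) + n / (2 * d) := by field_simp; ring
        linarith
      have h3 : ((n : ℝ) / (2 * d)) ^ 2 ≤ ((k : ℝ) - n / d) ^ 2 := by
        have : 0 ≤ (n : ℝ) / (2 * d) := by positivity
        nlinarith
      have h4 : (n : ℝ) ≤ 4 * d ^ 2 * θ * x ^ 2 := by
        rw [hx2]
        have h5 : (n : ℝ) = 4 * d ^ 2 * θ * (((n : ℝ) / (2 * d)) ^ 2 / (θ * n)) := by
          field_simp
          ring
        calc (n : ℝ) = 4 * d ^ 2 * θ * (((n : ℝ) / (2 * d)) ^ 2 / (θ * n)) := h5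
          _ ≤ _ := by gcongr
      have h6 : x ^ 2 ≤ (1 + |x|) ^ 2 := by
        rw [← sq_abs]
        gcongr
        linarith
      have h7 : 4 * d ^ 2 * θ ≤ 2 + K := by linarith
      calc t ≤ n := h1
        _ ≤ 4 * d ^ 2 * θ * x ^ 2 := h4
        _ ≤ (2 + K) * (1 + |x|) ^ 2 := by gcongr
  have htB' : t⁻¹ ≤ B := by
    have h1 : t⁻¹ ≤ 2 := by
      rw [ht, inv_div, div_le_iff₀ hn']
      linarith
    nlinarith
  have hw : poissonWeight d n k ^ 2 ≤ t * Real.exp (-(θ / 2 * |x| ^ 2)) := by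
    have h1 := pow_le_pow_left₀ (poissonWeight_nonneg hd0 n k) (poissonWeight_le hd hn hk) 2
    refine h1.trans (le_of_eq ?_)
    rw [mul_pow, Real.sq_sqrt ht0.le, ← Real.exp_nat_mul, sq_abs, hx2]
    congr 2
    push_cast
    field_simp
    ring
  have hinv : (((k : ℝ) + 1) / n) ^ (-e) = t ^ e := by
    rw [Real.rpow_neg (by positivity), ← Real.inv_rpow (by positivity), inv_div]
  have hB0 : 0 < B := by positivity
  calc poissonWeight d n k ^ 2 * (((k : ℝ) + 1) / n) ^ (-e) * (1 + |x|) ^ M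
      ≤ (B * Real.exp (-(θ / 2 * |x| ^ 2))) * B ^ |e| * (1 + |x|) ^ M := by
        rw [hinv]
        gcongr
        · exact hw.trans (by gcongr)
        · exact rpow_le_rpow_abs e ht0 htB htB'
    _ = B ^ (1 + |e|) * (1 + |x|) ^ M * Real.exp (-(θ / 2 * |x| ^ 2)) := by
        rw [Real.rpow_add hB0, Real.rpow_one]; ring
    _ = (2 + K) ^ (1 + |e|) *
          ((1 + |x|) ^ (2 + 2 * |e| + M) * Real.exp (-(θ / 2 * |x| ^ 2))) := by
        have h1 : (0 : ℝ) < 1 + |x| := by positivity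
        rw [hB, Real.mul_rpow (by positivity) (by positivity), ← Real.rpow_natCast (1 + |x|),
          ← Real.rpow_mul h1.le, mul_assoc, mul_assoc, ← mul_assoc ((1 + |x|) ^ _),
          ← Real.rpow_add h1]
        congr 4
        push_cast
        ring
    _ ≤ _ := by gcongr; exact hC _ hax

/-! ### Factorization of the summand. -/

/-- The product of the reciprocal `gammaQuot`s of one row. -/
noncomputable def rowCorrection (θ t : ℝ) (k : ℕ) : ℝ :=
  (gammaQuot (θ + θ * t) k * gammaQuot (1 + θ * t) k)⁻¹

/-- The product of the `gammaQuot` ratios of one pair of rows. -/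
noncomputable def pairCorrection (θ t : ℝ) (k : ℕ) : ℝ :=
  gammaQuot (θ + θ * (t + 1)) k / gammaQuot (θ + θ * t) k *
    (gammaQuot (1 + θ * (t + 1)) k / gammaQuot (1 + θ * t) k)

section Correction

variable {θ t : ℝ}

theorem rowCorrection_pos (hθ : 0 < θ) (ht : 0 ≤ t) (k : ℕ) : 0 < rowCorrection θ t k :=
  inv_pos.2 (mul_pos (gammaQuot_pos (by positivity) k) (gammaQuot_pos (by positivity) k))

theorem pairCorrection_pos (hθ : 0 < θ) (ht : 0 ≤ t) (k : ℕ) : 0 < pairCorrection θ t k :=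
  mul_pos (div_pos (gammaQuot_pos (by positivity) k) (gammaQuot_pos (by positivity) k))
    (div_pos (gammaQuot_pos (by positivity) k) (gammaQuot_pos (by positivity) k))

theorem tendsto_rowCorrection (hθ : 0 < θ) (ht : 0 ≤ t) :
    Filter.Tendsto (rowCorrection θ t) Filter.atTop (nhds 1) := by
  have h := ((tendsto_gammaQuot (a := θ + θ * t) (by positivity)).mul
    (tendsto_gammaQuot (a := 1 + θ * t) (by positivity))).inv₀ (by norm_num)
  rw [mul_one, inv_one] at h
  exact h

theorem tendsto_pairCorrection (hθ : 0 < θ) (ht : 0 ≤ t) :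
    Filter.Tendsto (pairCorrection θ t) Filter.atTop (nhds 1) := by
  have h := ((tendsto_gammaQuot (a := θ + θ * (t + 1)) (by positivity)).div
    (tendsto_gammaQuot (a := θ + θ * t) (by positivity)) one_ne_zero).mul
    ((tendsto_gammaQuot (a := 1 + θ * (t + 1)) (by positivity)).div
    (tendsto_gammaQuot (a := 1 + θ * t) (by positivity)) one_ne_zero)
  rw [div_one, mul_one] at h
  exact h

end Correction

/-- The two Gamma values supply 1/k!², hence a squared Poisson weight. The last bracket becomes a
function of n alone after multiplication over the rows, because the λ_i sum to n. -/
theorem inv_Gamma_mul_Gamma_eq {d : ℝ} (hd : 0 < d) (θ t : ℝ) {n : ℕ} (hn : 0 < n) (k : ℕ) :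
    (Real.Gamma (k + (θ + θ * t)) * Real.Gamma (k + (1 + θ * t)))⁻¹ =
      poissonWeight d n k ^ 2 * (((k : ℝ) + 1) / n) ^ (-(θ + 2 * θ * t - 1)) *
        rowCorrection θ t k *
        (Real.exp (2 * (n / d)) * ((n : ℝ) / d)⁻¹ ^ (2 * k) * (n : ℝ) ^ (-(θ + 2 * θ * t))) := by
  have hn' : (0 : ℝ) < n := by exact_mod_cast hn
  have hk : (0 : ℝ) < (k : ℝ) + 1 := by positivity
  rw [Gamma_eq_gammaQuot_mul, Gamma_eq_gammaQuot_mul, rowCorrection, poissonWeight,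
    Real.div_rpow hk.le hn'.le, mul_pow, Real.sq_sqrt hn'.le, two_mul (n / d : ℝ), Real.exp_add,
    Real.exp_neg]
  have e1 : ((k : ℝ) + 1) ^ (-(θ + 2 * θ * t - 1)) =
      (((k : ℝ) + 1) ^ (θ + θ * t - 1))⁻¹ * (((k : ℝ) + 1) ^ (1 + θ * t - 1))⁻¹ := by
    rw [← Real.rpow_neg hk.le, ← Real.rpow_neg hk.le, ← Real.rpow_add hk]
    congr 1
    ring
  have e2 : (n : ℝ) ^ (-(θ + 2 * θ * t)) = (n : ℝ) ^ (-(θ + 2 * θ * t - 1)) * (n : ℝ)⁻¹ := by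
    rw [← Real.rpow_neg_one (n : ℝ), ← Real.rpow_add hn']
    congr 1
    ring
  rw [e1, e2]
  have h1 : (0 : ℝ) < (n : ℝ) ^ (-(θ + 2 * θ * t - 1)) := by positivity
  have h2 : (0 : ℝ) < k.factorial := by positivity
  have h3 : (0 : ℝ) < ((n : ℝ) / d) := by positivity
  simp only [mul_inv, inv_pow, pow_mul']
  generalize (n : ℝ) / d = m at *
  generalize (((k : ℝ) + 1) ^ (θ + θ * t - 1))⁻¹ = p
  generalize (((k : ℝ) + 1) ^ (1 + θ * t - 1))⁻¹ = q
  generalize (gammaQuot (θ + θ * t) k)⁻¹ = p'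
  generalize (gammaQuot (1 + θ * t) k)⁻¹ = q'
  generalize (n : ℝ) ^ (-(θ + 2 * θ * t - 1)) = N at *
  have h4 := Real.exp_pos m
  field_simp

/-- The factorials cancel in each quotient and leave (k + 1)^θ; the two hook products together give
the exponent 2θ of the Vandermonde factor. -/
theorem Gamma_div_mul_Gamma_div_eq {θ t : ℝ} {r : ℝ} (hr : 0 < r) (k : ℕ) :
    Real.Gamma (k + (θ + θ * (t + 1))) / Real.Gamma (k + (θ + θ * t)) *
      (Real.Gamma (k + (1 + θ * (t + 1))) / Real.Gamma (k + (1 + θ * t))) =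
      (((k : ℝ) + 1) / r) ^ (2 * θ) * pairCorrection θ t k * r ^ (2 * θ) := by
  have hk : (0 : ℝ) < (k : ℝ) + 1 := by positivity
  have e : ∀ s : ℝ, Real.Gamma (k + (s + θ * (t + 1))) / Real.Gamma (k + (s + θ * t)) =
      gammaQuot (s + θ * (t + 1)) k / gammaQuot (s + θ * t) k * ((k : ℝ) + 1) ^ θ := by
    intro s
    have e1 : ((k : ℝ) + 1) ^ (s + θ * (t + 1) - 1) =
        ((k : ℝ) + 1) ^ (s + θ * t - 1) * ((k : ℝ) + 1) ^ θ := by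
      rw [← Real.rpow_add hk]
      congr 1
      ring
    have h1 : (0 : ℝ) < ((k : ℝ) + 1) ^ (s + θ * t - 1) := by positivity
    have h2 : (0 : ℝ) < k.factorial := by positivity
    rw [Gamma_eq_gammaQuot_mul, Gamma_eq_gammaQuot_mul, e1, mul_div_mul_comm]
    congr 1
    field_simp
  have h3 : (0 : ℝ) < r ^ (2 * θ) := by positivity
  have e2 : ((k : ℝ) + 1) ^ (2 * θ) = ((k : ℝ) + 1) ^ θ * ((k : ℝ) + 1) ^ θ := by
    rw [← Real.rpow_add hk]
    congr 1
    ring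
  rw [e, e, pairCorrection, Real.div_rpow hk.le hr.le, e2]
  field_simp

/-- The normalized summand of the partition `v`. -/
noncomputable def partitionWeight (θ : ℝ) (d n : ℕ) (v : Fin d → ℕ) : ℝ :=
  (∏ i : Fin d, poissonWeight d n (v i) ^ 2 *
    (((v i : ℝ) + 1) / n) ^ (-(θ + 2 * θ * ((d : ℝ) - i - 1) - 1)) *
      rowCorrection θ ((d : ℝ) - i - 1) (v i)) *
  ∏ i : Fin d, ∏ j ∈ Finset.Ioi i, ((((v i - v j : ℕ) : ℝ) + 1) / √(θ * n)) ^ (2 * θ) *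
    pairCorrection θ ((j : ℝ) - i - 1) (v i - v j)

theorem sub_sub_one_nonneg {d : ℕ} (i : Fin d) : (0 : ℝ) ≤ (d : ℝ) - i - 1 := by
  have : (i : ℝ) + 1 ≤ d := by exact_mod_cast i.2
  linarith

theorem sub_sub_one_nonneg_of_mem_Ioi {d : ℕ} {i j : Fin d} (h : j ∈ Finset.Ioi i) :
    (0 : ℝ) ≤ (j : ℝ) - i - 1 := by
  have : (i : ℝ) + 1 ≤ j := by exact_mod_cast Fin.lt_def.1 (Finset.mem_Ioi.1 h)
  linarith

theorem partitionWeight_nonneg {θ : ℝ} (hθ : 0 < θ) {d : ℕ} (n : ℕ) (v : Fin d → ℕ) :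
    0 ≤ partitionWeight θ d n v := by
  refine mul_nonneg (Finset.prod_nonneg fun i _ => ?_)
    (Finset.prod_nonneg fun i _ => Finset.prod_nonneg fun j hj => ?_)
  · have := (rowCorrection_pos hθ (sub_sub_one_nonneg i) (v i)).le
    positivity
  · have := (pairCorrection_pos hθ (sub_sub_one_nonneg_of_mem_Ioi hj) (v i - v j)).le
    positivity

theorem sum_fin_cast (d : ℕ) : ∑ i : Fin d, (i : ℝ) = (d : ℝ) * (d - 1) / 2 := by
  rw [Fin.sum_univ_eq_sum_range (fun i => (i : ℝ))]
  induction d with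
  | zero => simp
  | succ d ih =>
    rw [Finset.sum_range_succ, ih]
    push_cast
    ring

theorem sum_rowExponent (θ : ℝ) (d : ℕ) :
    ∑ i : Fin d, (θ + 2 * θ * ((d : ℝ) - i - 1)) = θ * (d : ℝ) ^ 2 := by
  simp only [Finset.sum_add_distrib, ← Finset.mul_sum, Finset.sum_sub_distrib, sum_fin_cast,
    Finset.sum_const, Finset.card_univ, Fintype.card_fin, nsmul_eq_mul]
  ring

theorem sum_pairExponent (c : ℝ) (d : ℕ) :
    ∑ i : Fin d, ∑ _j ∈ Finset.Ioi i, c = c * ((d : ℝ) * (d - 1) / 2) := by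
  have h : ∀ i : Fin d, ∑ _j ∈ Finset.Ioi i, c = ((d : ℝ) - 1 - i) * c := by
    intro i
    rw [Finset.sum_const, Fin.card_Ioi, nsmul_eq_mul]
    congr 1
    have := i.2
    rw [Nat.sub_sub, Nat.cast_sub (by omega)]
    push_cast
    ring
  rw [Finset.sum_congr rfl fun i _ => h i, ← Finset.sum_mul, Finset.sum_sub_distrib, sum_fin_cast]
  simp only [Finset.sum_const, Finset.card_univ, Fintype.card_fin, nsmul_eq_mul]
  ring

theorem prod_prod_const_rpow {A : ℝ} (hA : 0 < A) (c : ℝ) (d : ℕ) :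
    ∏ i : Fin d, ∏ _j ∈ Finset.Ioi i, A ^ c = A ^ (c * ((d : ℝ) * (d - 1) / 2)) := by
  rw [← sum_pairExponent, Real.rpow_sum_of_pos hA]
  exact Finset.prod_congr rfl fun i _ => (Real.rpow_sum_of_pos hA _ _).symm

theorem summand_eq_partitionWeight {d : ℕ} (hd : 1 ≤ d) {α : ℝ} (hα : 0 < α) {n : ℕ} (hn : 0 < n)
    {μ : YoungDiagram} (hμ : μ ∈ partitionsOfLengthLE n d) :
    ((n.factorial : ℝ) / jackHookLower α μ) * ((n.factorial : ℝ) / jackHookUpper α μ) =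
      (α⁻¹ ^ (2 * n) * Real.Gamma (1 / α) ^ d * (poissonWeight 1 n n)⁻¹ ^ 2 *
        (n : ℝ) ^ (1 - 1 / α * (d : ℝ) ^ 2) * (d : ℝ) ^ (2 * n) *
        √(1 / α * n) ^ (2 * (1 / α) * ((d : ℝ) * (d - 1) / 2))) *
        partitionWeight (1 / α) d n fun i => μ.rowLen i := by
  rw [mem_partitionsOfLengthLE] at hμ
  have hn' : (0 : ℝ) < n := by exact_mod_cast hn
  have hd' : (0 : ℝ) < d := by exact_mod_cast hd
  have hθ : 0 < 1 / α := by positivity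
  set θ := 1 / α with hθd
  have hr : 0 < √(θ * n) := Real.sqrt_pos.2 (by positivity)
  have hL : jackHookLower α μ = ∏ c ∈ μ.cells, (α * armLength μ c + legLength μ c + α * θ) := by
    rw [hθd, mul_one_div_cancel hα.ne']; rfl
  have hU : jackHookUpper α μ = ∏ c ∈ μ.cells, (α * armLength μ c + legLength μ c + α * 1) := by
    rw [mul_one]; rfl
  rw [YoungDiagram.hook_prod μ hα hθ hμ.2, ← hθd] at hL
  rw [YoungDiagram.hook_prod μ hα one_pos hμ.2, ← hθd, Real.Gamma_one] at hU
  set v : Fin d → ℕ := fun i => μ.rowLen i with hv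
  have hsum : ∑ i, v i = n := by
    rw [← hμ.1, YoungDiagram.card_eq_sum_rowLen hμ.2, Finset.sum_range]
  have hprod : (jackHookLower α μ * jackHookUpper α μ)⁻¹ =
      α⁻¹ ^ (2 * n) * ∏ i : Fin d, (Real.Gamma θ *
        (Real.Gamma (v i + (θ + θ * ((d : ℝ) - i - 1))) *
          Real.Gamma (v i + (1 + θ * ((d : ℝ) - i - 1))))⁻¹ *
        ∏ j ∈ Finset.Ioi i,
          (Real.Gamma (((v i - v j : ℕ) : ℝ) + (θ + θ * (((j : ℝ) - i - 1) + 1))) /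
            Real.Gamma (((v i - v j : ℕ) : ℝ) + (θ + θ * ((j : ℝ) - i - 1))) *
          (Real.Gamma (((v i - v j : ℕ) : ℝ) + (1 + θ * (((j : ℝ) - i - 1) + 1))) /
            Real.Gamma (((v i - v j : ℕ) : ℝ) + (1 + θ * ((j : ℝ) - i - 1)))))) := by
    rw [hL, hU, hμ.1, mul_mul_mul_comm, mul_inv, ← pow_add, ← two_mul, inv_pow,
      ← Finset.prod_mul_distrib, ← Finset.prod_inv_distrib]
    congr 1
    refine Finset.prod_congr rfl fun i _ => ?_
    rw [mul_mul_mul_comm, ← Finset.prod_mul_distrib, mul_inv, ← Finset.prod_inv_distrib]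
    congr 1
    · rw [div_one, div_mul_eq_mul_div, inv_div, div_eq_mul_inv]
    · refine Finset.prod_congr rfl fun j _ => ?_
      rw [mul_inv, inv_div, inv_div, sub_add_cancel]
  -- Expressing n! by the Poisson weight of mean n at n makes e^(-2n) cancel against the rows and
  -- reduces n^(2n) (n/d)^(-2n) to d^(2n).
  have hfac : (n.factorial : ℝ) ^ 2 = n * (n : ℝ) ^ (2 * n) * Real.exp (-(2 * n)) *
      (poissonWeight 1 n n)⁻¹ ^ 2 := by
    have h1 : (0 : ℝ) < n.factorial := by positivity
    rw [poissonWeight, div_one, inv_pow, mul_pow, Real.sq_sqrt hn'.le, two_mul (n : ℝ), neg_add,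
      Real.exp_add]
    have := Real.exp_pos (-(n : ℝ))
    field_simp
    ring
  have hpp := prod_prod_const_rpow hr (2 * θ) d
  simp only [Finset.prod_const] at hpp
  rw [div_mul_div_comm, div_eq_mul_inv, hprod, ← sq, hfac]
  simp only [inv_Gamma_mul_Gamma_eq hd' θ _ hn, Gamma_div_mul_Gamma_div_eq hr,
    Finset.prod_mul_distrib, Finset.prod_const, Finset.card_univ, Fintype.card_fin]
  rw [hpp, ← Real.rpow_sum_of_pos hn', Finset.prod_pow_eq_pow_sum,
    ← Finset.mul_sum, hsum, Finset.sum_neg_distrib, sum_rowExponent, ← Real.exp_nat_mul,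
    partitionWeight]
  simp only [Finset.prod_mul_distrib]
  have e1 : (n : ℝ) ^ (1 - θ * (d : ℝ) ^ 2) = n * (n : ℝ) ^ (-(θ * (d : ℝ) ^ 2)) := by
    rw [sub_eq_add_neg, Real.rpow_add hn', Real.rpow_one]
  have e2 : (d : ℝ) * (2 * (n / d)) = 2 * n := by field_simp
  have e3 : Real.exp (-(2 * (n : ℝ))) * Real.exp (2 * n) = 1 := by
    rw [← Real.exp_add]; simp
  have e4 : (n : ℝ) ^ (2 * n) * ((n : ℝ) / d)⁻¹ ^ (2 * n) = (d : ℝ) ^ (2 * n) := by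
    rw [← mul_pow]
    congr 1
    field_simp
  have e5 : ∀ X : ℝ, Real.exp (-(2 * (n : ℝ))) * Real.exp (2 * n) * X = X := fun X => by
    rw [e3, one_mul]
  rw [e1, e2, ← e4]
  refine Eq.trans ?_ (e5 _)
  ring

/-! ### Pointwise limit and domination of the weight. -/

/-- Strict monotonicity of x sends every λ_i - λ_j to infinity, so that the pair corrections tend to
1. Since λ_i/n tends to 1/d, the row powers combine to d^(θd²). -/
theorem tendsto_partitionWeight {θ : ℝ} (hθ : 0 < θ) {d : ℕ} (hd : 1 ≤ d)
    {v : ℕ → Fin d → ℕ} {x : Fin d → ℝ} (hx : StrictAnti x) (hv : ∀ᶠ n in Filter.atTop, Antitone (v n))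
    (h : ∀ i, Filter.Tendsto (fun n : ℕ => ((v n i : ℝ) - n / d) / √(θ * n)) Filter.atTop
      (nhds (x i))) :
    Filter.Tendsto (fun n => partitionWeight θ d n (v n)) Filter.atTop
      (nhds ((2 * Real.pi)⁻¹ ^ d * (d : ℝ) ^ (θ * (d : ℝ) ^ 2) *
        (Real.exp (-((d : ℝ) * (2 * θ) / 2) * ∑ i, x i ^ 2) *
          ∏ i : Fin d, ∏ j ∈ Finset.Ioi i, (x i - x j) ^ (2 * θ)))) := by
  have hd' : (0 : ℝ) < d := by exact_mod_cast hd
  have hr : Filter.Tendsto (fun n : ℕ => √(θ * n)) Filter.atTop Filter.atTop :=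
    Real.tendsto_sqrt_atTop.comp (tendsto_natCast_atTop_atTop.const_mul_atTop hθ)
  have hrow : ∀ i : Fin d, Filter.Tendsto (fun n => poissonWeight d n (v n i) ^ 2 *
    (((v n i : ℝ) + 1) / n) ^ (-(θ + 2 * θ * ((d : ℝ) - i - 1) - 1)) *
      rowCorrection θ ((d : ℝ) - i - 1) (v n i)) Filter.atTop
      (nhds ((√((d : ℝ) / (2 * Real.pi)) * Real.exp (-((d : ℝ) * θ * x i ^ 2 / 2))) ^ 2 *
        (1 / (d : ℝ)) ^ (-(θ + 2 * θ * ((d : ℝ) - i - 1) - 1)) * 1)) := by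
    intro i
    obtain ⟨h1, h2⟩ := tendsto_poissonWeight hd' hθ (h i)
    have h3 : Filter.Tendsto (fun n : ℕ => ((v n i : ℝ) + 1) / n) Filter.atTop
        (nhds (1 / (d : ℝ))) := by
      have := h1.add (tendsto_const_div_atTop_nhds_zero_nat (1 : ℝ))
      rw [add_zero] at this
      refine this.congr fun n => ?_
      rw [add_div]
    have h4 : Filter.Tendsto (fun n => v n i) Filter.atTop Filter.atTop := by
      rw [← tendsto_natCast_atTop_iff (R := ℝ)]
      have := h1.pos_mul_atTop (by positivity) (tendsto_natCast_atTop_atTop (R := ℝ))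
      refine this.congr' ?_
      filter_upwards [Filter.eventually_gt_atTop 0] with n hn
      have hn' : (0 : ℝ) < n := by exact_mod_cast hn
      field_simp
    exact ((h2.pow 2).mul (h3.rpow_const (Or.inl (by positivity)))).mul
      ((tendsto_rowCorrection hθ (sub_sub_one_nonneg i)).comp h4)
  have hpair : ∀ i : Fin d, ∀ j ∈ Finset.Ioi i, Filter.Tendsto (fun n : ℕ =>
      ((((v n i - v n j : ℕ) : ℝ) + 1) / √(θ * n)) ^ (2 * θ) *
        pairCorrection θ ((j : ℝ) - i - 1) (v n i - v n j)) Filter.atTop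
      (nhds ((x i - x j) ^ (2 * θ) * 1)) := by
    intro i j hj
    have hij := hx (Finset.mem_Ioi.1 hj)
    have h1 := (h i).sub (h j)
    have hcast : ∀ᶠ n in Filter.atTop, ((v n i - v n j : ℕ) : ℝ) = (v n i : ℝ) - v n j := by
      filter_upwards [hv] with n hn
      rw [Nat.cast_sub (hn (Finset.mem_Ioi.1 hj).le)]
    have h2 : Filter.Tendsto (fun n : ℕ => (((v n i - v n j : ℕ) : ℝ) + 1) / √(θ * n))
        Filter.atTop (nhds (x i - x j)) := by
      have := h1.add (tendsto_inv_atTop_zero.comp hr)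
      rw [add_zero] at this
      refine this.congr' ?_
      filter_upwards [hcast] with n hn
      rw [hn, Function.comp_apply]
      ring
    have h3 : Filter.Tendsto (fun n => v n i - v n j) Filter.atTop Filter.atTop := by
      rw [← tendsto_natCast_atTop_iff (R := ℝ)]
      have := h1.pos_mul_atTop (sub_pos.2 hij) hr
      refine this.congr' ?_
      filter_upwards [hcast, hr.eventually_gt_atTop 0] with n hn hn0
      rw [hn, ← sub_div, div_mul_cancel₀ _ hn0.ne']
      ring
    exact (h2.rpow_const (Or.inr (by positivity))).mul
      ((tendsto_pairCorrection hθ (sub_sub_one_nonneg_of_mem_Ioi hj)).comp h3)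
  have hall := (tendsto_finsetProd Finset.univ fun i _ => hrow i).mul
    (tendsto_finsetProd Finset.univ fun i _ => tendsto_finsetProd (Finset.Ioi i) (hpair i))
  have hval : ∀ i : Fin d, (√((d : ℝ) / (2 * Real.pi)) *
      Real.exp (-((d : ℝ) * θ * x i ^ 2 / 2))) ^ 2 *
        (1 / (d : ℝ)) ^ (-(θ + 2 * θ * ((d : ℝ) - i - 1) - 1)) * 1 =
      (2 * Real.pi)⁻¹ * (d : ℝ) ^ (θ + 2 * θ * ((d : ℝ) - i - 1)) *
        Real.exp (-((d : ℝ) * (2 * θ) / 2) * x i ^ 2) := by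
    intro i
    rw [mul_one, mul_pow, Real.sq_sqrt (by positivity), ← Real.exp_nat_mul, one_div,
      Real.inv_rpow hd'.le, ← Real.rpow_neg hd'.le, neg_neg, Real.rpow_sub_one hd'.ne']
    have : ((2 : ℕ) : ℝ) * -((d : ℝ) * θ * x i ^ 2 / 2) =
      -((d : ℝ) * (2 * θ) / 2) * x i ^ 2 := by push_cast; ring
    rw [this]
    field_simp
  rw [Finset.prod_congr rfl fun i _ => hval i] at hall
  simp only [mul_one] at hall
  rw [Finset.prod_mul_distrib, Finset.prod_mul_distrib, Finset.prod_const, Finset.card_univ,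
    Fintype.card_fin, ← Real.rpow_sum_of_pos hd', sum_rowExponent, ← Real.exp_sum,
    ← Finset.mul_sum, mul_assoc] at hall
  exact hall

theorem le_prod_of_one_le {ι : Type*} [Fintype ι] {f : ι → ℝ} (hf : ∀ i, 1 ≤ f i) (i : ι) :
    f i ≤ ∏ j, f j := by
  classical
  rw [← Finset.mul_prod_erase _ _ (Finset.mem_univ i)]
  have : 1 ≤ ∏ j ∈ Finset.univ.erase i, f j := by
    rw [← Finset.prod_const_one (s := Finset.univ.erase i)]
    exact Finset.prod_le_prod (fun _ _ => zero_le_one) fun j _ => hf j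
  nlinarith [hf i]

/-- The pair factors grow at most like the power E of ∏(1 + |ξ_i|), where E is 2θ times the number
of pairs. The rows decay faster than any power; requesting the power E + 2 leaves the exponent -2,
integrable in each variable. -/
theorem exists_partitionWeight_le {θ : ℝ} (hθ : 0 < θ) {d : ℕ} (hd : 1 ≤ d) :
    ∃ C, 0 ≤ C ∧ ∀ n, 0 < n → ∀ v ∈ antitoneCompositions n d, partitionWeight θ d n v ≤
      C * ∏ i, (1 + |((v i : ℝ) - n / d) / √(θ * n)|) ^ (-2 : ℝ) := by
  have hd' : (1 : ℝ) ≤ d := by exact_mod_cast hd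
  set E : ℝ := 2 * θ * ((d : ℝ) * (d - 1) / 2) with hE
  have hE0 : 0 ≤ E := by
    have : (0 : ℝ) ≤ d - 1 := by linarith
    positivity
  have hrow : ∀ i : Fin d, ∃ C, 0 < C ∧ ∀ k, rowCorrection θ ((d : ℝ) - i - 1) k ≤ C := by
    intro i
    obtain ⟨C, hC, h⟩ := exists_pos_bounds_of_tendsto one_pos
      (rowCorrection_pos hθ (sub_sub_one_nonneg i)) (tendsto_rowCorrection hθ (sub_sub_one_nonneg i))
    exact ⟨C, hC, fun k => (h k).1⟩
  have hpair : ∀ i j : Fin d, ∃ C, 0 < C ∧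
      (j ∈ Finset.Ioi i → ∀ k, pairCorrection θ ((j : ℝ) - i - 1) k ≤ C) := by
    intro i j
    by_cases hj : j ∈ Finset.Ioi i
    · have h0 := sub_sub_one_nonneg_of_mem_Ioi hj
      obtain ⟨C, hC, h⟩ := exists_pos_bounds_of_tendsto one_pos (pairCorrection_pos hθ h0)
        (tendsto_pairCorrection hθ h0)
      exact ⟨C, hC, fun _ k => (h k).1⟩
    · exact ⟨1, one_pos, fun h => absurd h hj⟩
  choose R hR0 hR using hrow
  choose P hP0 hP using hpair
  choose Q hQ0 hQ using fun i : Fin d =>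
    exists_poissonWeight_sq_mul_le hd' hθ (θ + 2 * θ * ((d : ℝ) - i - 1) - 1) (E + 2)
  -- The 2 covers ξ_i - ξ_j and 1/√θ covers the added 1 divided by r, as r ≥ √θ for n ≥ 1.
  set K : ℝ := 2 + 1 / √θ with hK
  have hsθ : 0 < √θ := Real.sqrt_pos.2 hθ
  have hK0 : 0 < K := by positivity
  have hPP : 0 ≤ ∏ i : Fin d, ∏ j ∈ Finset.Ioi i, P i j :=
    Finset.prod_nonneg fun i _ => Finset.prod_nonneg fun j _ => (hP0 i j).le
  have hQR : 0 ≤ ∏ i : Fin d, (Q i * R i) :=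
    Finset.prod_nonneg fun i _ => mul_nonneg (hQ0 i) (hR0 i).le
  refine ⟨(∏ i : Fin d, (Q i * R i)) * (K ^ E * ∏ i : Fin d, ∏ j ∈ Finset.Ioi i, P i j),
    by positivity, fun n hn v hv => ?_⟩
  rw [mem_antitoneCompositions] at hv
  have hn' : (1 : ℝ) ≤ n := by exact_mod_cast hn
  set r := √(θ * n) with hr
  have hr0 : 0 < r := Real.sqrt_pos.2 (by positivity)
  have hrθ : √θ ≤ r := Real.sqrt_le_sqrt (by nlinarith)
  set ξ : Fin d → ℝ := fun i => ((v i : ℝ) - n / d) / r with hξ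
  set A : ℝ := ∏ i, (1 + |ξ i|) with hA
  have hone : ∀ i, 1 ≤ 1 + |ξ i| := fun i => by linarith [abs_nonneg (ξ i)]
  have hpos : ∀ i, 0 < 1 + |ξ i| := fun i => by linarith [hone i]
  have hA0 : 0 < A := Finset.prod_pos fun i _ => hpos i
  have hiA : ∀ i, 1 + |ξ i| ≤ A := le_prod_of_one_le hone
  have hbase : ∀ i, ∀ j ∈ Finset.Ioi i, (((v i - v j : ℕ) : ℝ) + 1) / r ≤ K * A := by
    intro i j hj
    rw [Nat.cast_sub (hv.2 (Finset.mem_Ioi.1 hj).le)]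
    have e : ((v i : ℝ) - v j + 1) / r = ξ i - ξ j + 1 / r := by
      rw [hξ]; ring
    have h1 : 1 / r ≤ 1 / √θ := one_div_le_one_div_of_le hsθ hrθ
    have h2 : 1 / √θ ≤ 1 / √θ * A :=
      le_mul_of_one_le_right (by positivity) ((hone i).trans (hiA i))
    have h3 := le_abs_self (ξ i)
    have h4 := neg_abs_le (ξ j)
    have h5 := hiA i
    have h6 := hiA j
    rw [e, hK, add_mul]
    linarith
  have hpairs : ∏ i : Fin d, ∏ j ∈ Finset.Ioi i,
      ((((v i - v j : ℕ) : ℝ) + 1) / r) ^ (2 * θ) * pairCorrection θ ((j : ℝ) - i - 1) (v i - v j) ≤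
      (K ^ E * ∏ i : Fin d, ∏ j ∈ Finset.Ioi i, P i j) * ∏ i, (1 + |ξ i|) ^ E := by
    have h1 : ∏ i : Fin d, ∏ j ∈ Finset.Ioi i, ((((v i - v j : ℕ) : ℝ) + 1) / r) ^ (2 * θ) *
        pairCorrection θ ((j : ℝ) - i - 1) (v i - v j) ≤
        ∏ i : Fin d, ∏ j ∈ Finset.Ioi i, (K * A) ^ (2 * θ) * P i j := by
      have h0 : ∀ i : Fin d, ∀ j ∈ Finset.Ioi i, 0 ≤ ((((v i - v j : ℕ) : ℝ) + 1) / r) ^ (2 * θ) *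
        pairCorrection θ ((j : ℝ) - i - 1) (v i - v j) := fun i j hj => by
          have := (pairCorrection_pos hθ (sub_sub_one_nonneg_of_mem_Ioi hj) (v i - v j)).le
          positivity
      refine Finset.prod_le_prod (fun i _ => Finset.prod_nonneg (h0 i)) fun i _ =>
        Finset.prod_le_prod (h0 i) fun j hj => ?_
      refine mul_le_mul ?_ (hP i j hj _)
        (pairCorrection_pos hθ (sub_sub_one_nonneg_of_mem_Ioi hj) _).le (by positivity)
      exact Real.rpow_le_rpow (by positivity) (hbase i j hj) (by positivity)
    refine h1.trans (le_of_eq ?_)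
    rw [Finset.prod_congr rfl fun i _ => Finset.prod_mul_distrib, Finset.prod_mul_distrib,
      prod_prod_const_rpow (by positivity), ← hE, Real.mul_rpow hK0.le hA0.le,
      Real.finsetProd_rpow _ _ fun i _ => (hpos i).le]
    ring
  have hrows : ∏ i : Fin d, (poissonWeight d n (v i) ^ 2 *
      (((v i : ℝ) + 1) / n) ^ (-(θ + 2 * θ * ((d : ℝ) - i - 1) - 1)) *
      rowCorrection θ ((d : ℝ) - i - 1) (v i)) ≤
      ∏ i : Fin d, ((Q i * R i) * (1 + |ξ i|) ^ (-(E + 2))) := by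
    refine Finset.prod_le_prod (fun i _ => ?_) fun i _ => ?_
    · have := (rowCorrection_pos hθ (sub_sub_one_nonneg i) (v i)).le
      positivity
    · have hvn : v i ≤ n := by
        rw [← hv.1]
        exact Finset.single_le_sum (fun _ _ => Nat.zero_le _) (Finset.mem_univ i)
      have h1 := hQ i n (v i) hn hvn
      have h2 : poissonWeight d n (v i) ^ 2 *
          (((v i : ℝ) + 1) / n) ^ (-(θ + 2 * θ * ((d : ℝ) - i - 1) - 1)) ≤
          Q i * (1 + |ξ i|) ^ (-(E + 2)) := by
        rw [Real.rpow_neg (hpos i).le, ← div_eq_mul_inv,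
          le_div_iff₀ (Real.rpow_pos_of_pos (hpos i) _)]
        exact h1
      calc _ ≤ Q i * (1 + |ξ i|) ^ (-(E + 2)) * R i :=
            mul_le_mul h2 (hR i _) (rowCorrection_pos hθ (sub_sub_one_nonneg i) _).le
              (mul_nonneg (hQ0 i) (Real.rpow_pos_of_pos (hpos i) _).le)
        _ = _ := by ring
  have hfin : ∏ i, (1 + |ξ i|) ^ (-2 : ℝ) =
      (∏ i, (1 + |ξ i|) ^ (-(E + 2))) * ∏ i, (1 + |ξ i|) ^ E := by
    rw [← Finset.prod_mul_distrib]
    refine Finset.prod_congr rfl fun i _ => ?_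
    rw [← Real.rpow_add (hpos i)]
    congr 1
    ring
  have hpairs0 : 0 ≤ ∏ i : Fin d, ∏ j ∈ Finset.Ioi i,
      ((((v i - v j : ℕ) : ℝ) + 1) / r) ^ (2 * θ) *
        pairCorrection θ ((j : ℝ) - i - 1) (v i - v j) :=
    Finset.prod_nonneg fun i _ => Finset.prod_nonneg fun j hj => by
      have := (pairCorrection_pos hθ (sub_sub_one_nonneg_of_mem_Ioi hj) (v i - v j)).le
      positivity
  have hQE : 0 ≤ ∏ i : Fin d, ((Q i * R i) * (1 + |ξ i|) ^ (-(E + 2))) :=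
    Finset.prod_nonneg fun i _ =>
      mul_nonneg (mul_nonneg (hQ0 i) (hR0 i).le) (Real.rpow_pos_of_pos (hpos i) _).le
  refine (mul_le_mul hrows hpairs hpairs0 hQE).trans (le_of_eq ?_)
  rw [hfin, Finset.prod_mul_distrib]
  ring

/-! ### Geometry of the traceless chamber. -/

section TracelessExtend

variable {e : ℕ}

theorem tracelessExtend_castSucc (y : Fin e → ℝ) (i : Fin e) :
    tracelessExtend (e + 1) y i.castSucc = y i := by
  unfold tracelessExtend
  rw [dif_pos (show ((i.castSucc : Fin (e + 1)) : ℕ) < e + 1 - 1 from i.2)]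
  rfl

theorem tracelessExtend_last (y : Fin e → ℝ) :
    tracelessExtend (e + 1) y (Fin.last e) = -∑ i, y i := by
  unfold tracelessExtend
  rw [dif_neg (by simp)]
  rfl

theorem sum_tracelessExtend (y : Fin e → ℝ) : ∑ i, tracelessExtend (e + 1) y i = 0 := by
  simp [Fin.sum_univ_castSucc, tracelessExtend_castSucc, tracelessExtend_last]

theorem continuous_tracelessExtend (i : Fin (e + 1)) :
    Continuous fun y : Fin e → ℝ => tracelessExtend (e + 1) y i := by
  induction i using Fin.lastCases with
  | last => simp only [tracelessExtend_last]; fun_prop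
  | cast i => simp only [tracelessExtend_castSucc]; fun_prop

theorem tracelessExtend_mem_tracelessChamber {y : Fin e → ℝ} :
    tracelessExtend (e + 1) y ∈ tracelessChamber (e + 1) ↔
      Antitone (tracelessExtend (e + 1) y) := by
  simp only [tracelessChamber, Set.mem_ofPred_eq, sum_tracelessExtend, and_true]
  rfl

/-- Equally spaced centred points. They show that the coordinate differences are nonzero linear
forms and that the open chamber is nonempty. -/
theorem exists_strictAnti_tracelessExtend (e : ℕ) :
    ∃ y : Fin e → ℝ, StrictAnti (tracelessExtend (e + 1) y) := by
  refine ⟨fun i => (e : ℝ) / 2 - i, ?_⟩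
  have h : ∀ i : Fin (e + 1), tracelessExtend (e + 1) (fun i : Fin e => (e : ℝ) / 2 - i) i =
      (e : ℝ) / 2 - (i : ℕ) := by
    intro i
    induction i using Fin.lastCases with
    | last =>
      rw [tracelessExtend_last, Finset.sum_sub_distrib, sum_fin_cast]
      simp only [Finset.sum_const, Finset.card_univ, Fintype.card_fin, nsmul_eq_mul, Fin.val_last]
      ring
    | cast i => rw [tracelessExtend_castSucc]; rfl
  intro i j hij
  rw [h, h]
  have : (i : ℝ) < j := by exact_mod_cast Fin.lt_def.1 hij
  linarith

/-- The difference of two coordinates of `tracelessExtend`, as a linear functional. -/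
noncomputable def tracelessExtendSub (i j : Fin (e + 1)) : (Fin e → ℝ) →ₗ[ℝ] ℝ where
  toFun y := tracelessExtend (e + 1) y i - tracelessExtend (e + 1) y j
  map_add' y z := by
    have h : ∀ k, tracelessExtend (e + 1) (y + z) k =
        tracelessExtend (e + 1) y k + tracelessExtend (e + 1) z k := by
      intro k
      induction k using Fin.lastCases with
      | last => simp only [tracelessExtend_last, Pi.add_apply, Finset.sum_add_distrib]; ring
      | cast k => simp only [tracelessExtend_castSucc, Pi.add_apply]
    rw [h, h]
    ring
  map_smul' c y := by
    have h : ∀ k, tracelessExtend (e + 1) (c • y) k = c * tracelessExtend (e + 1) y k := by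
      intro k
      induction k using Fin.lastCases with
      | last =>
        simp only [tracelessExtend_last, Pi.smul_apply, smul_eq_mul, ← Finset.mul_sum]; ring
      | cast k => simp only [tracelessExtend_castSucc, Pi.smul_apply, smul_eq_mul]
    rw [h, h, RingHom.id_apply, smul_eq_mul]
    ring

/-- Each coincidence of coordinates is the kernel of a nonzero linear form, hence a null set. -/
theorem ae_tracelessExtend_injective :
    ∀ᵐ y : Fin e → ℝ, Function.Injective (tracelessExtend (e + 1) y) := by
  have h : ∀ i j : Fin (e + 1), i ≠ j →
      ∀ᵐ y : Fin e → ℝ, tracelessExtend (e + 1) y i ≠ tracelessExtend (e + 1) y j := by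
    intro i j hij
    have hne : LinearMap.ker (tracelessExtendSub i j) ≠ ⊤ := by
      obtain ⟨y, hy⟩ := exists_strictAnti_tracelessExtend e
      intro htop
      have hmem : y ∈ LinearMap.ker (tracelessExtendSub i j) := by rw [htop]; trivial
      exact hij (hy.injective (sub_eq_zero.1 (LinearMap.mem_ker.1 hmem)))
    rw [MeasureTheory.ae_iff]
    refine MeasureTheory.measure_mono_null ?_
      (MeasureTheory.Measure.addHaar_submodule MeasureTheory.volume _ hne)
    intro y hy
    simp only [ne_eq, not_not, Set.mem_ofPred_eq] at hy
    exact LinearMap.mem_ker.2 (sub_eq_zero.2 hy)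
  have h2 : ∀ᵐ y : Fin e → ℝ, ∀ i j : Fin (e + 1), i ≠ j →
      tracelessExtend (e + 1) y i ≠ tracelessExtend (e + 1) y j := by
    simp only [MeasureTheory.ae_all_iff]
    exact h
  filter_upwards [h2] with y hy i j hij
  by_contra hne
  exact hy i j hne hij

theorem measurableSet_tracelessChamber_preimage :
    MeasurableSet {y : Fin e → ℝ | tracelessExtend (e + 1) y ∈ tracelessChamber (e + 1)} := by
  refine IsClosed.measurableSet ?_
  simp only [tracelessExtend_mem_tracelessChamber, Antitone, Set.ofPred_forall]
  exact isClosed_iInter fun i => isClosed_iInter fun j => isClosed_iInter fun _ =>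
    isClosed_le (continuous_tracelessExtend j) (continuous_tracelessExtend i)

theorem isOpen_strictAnti_tracelessExtend :
    IsOpen {y : Fin e → ℝ | StrictAnti (tracelessExtend (e + 1) y)} := by
  simp only [StrictAnti, Set.ofPred_forall]
  exact isOpen_iInter_of_finite fun i => isOpen_iInter_of_finite fun j =>
    isOpen_iInter_of_finite fun _ =>
    isOpen_lt (continuous_tracelessExtend j) (continuous_tracelessExtend i)

end TracelessExtend

/-! ### The sum as the integral of a step function. -/

/-- The set of points `y` with `v_i ≤ n / d + √(θ n) y_i < v_i + 1` for all `i`. -/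
def partitionCell (θ : ℝ) {e : ℕ} (n : ℕ) (v : Fin (e + 1) → ℕ) : Set (Fin e → ℝ) :=
  Set.univ.pi fun i => Set.Ico (((v i.castSucc : ℝ) - n / ((e + 1 : ℕ) : ℝ)) / √(θ * n))
    (((v i.castSucc : ℝ) + 1 - n / ((e + 1 : ℕ) : ℝ)) / √(θ * n))

/-- The step function taking the value `partitionWeight θ (e + 1) n v` on the cell of `v`. -/
noncomputable def partitionStep (θ : ℝ) (e n : ℕ) (y : Fin e → ℝ) : ℝ :=
  ∑ v ∈ antitoneCompositions n (e + 1),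
    (partitionCell θ n v).indicator (fun _ => partitionWeight θ (e + 1) n v) y

section Cells

variable {θ : ℝ} {e n : ℕ} {v w : Fin (e + 1) → ℕ} {y : Fin e → ℝ}

theorem measurableSet_partitionCell : MeasurableSet (partitionCell θ n v) :=
  MeasurableSet.univ_pi fun _ => measurableSet_Ico

theorem volume_partitionCell :
    MeasureTheory.volume (partitionCell θ n v) = ENNReal.ofReal ((√(θ * n))⁻¹ ^ e) := by
  rw [partitionCell, Real.volume_pi_Ico, ENNReal.ofReal_pow (by positivity)]
  rw [← Fin.prod_const]
  refine Finset.prod_congr rfl fun i _ => ?_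
  congr 1
  ring

theorem integral_partitionStep (θ : ℝ) (e n : ℕ) :
    ∫ y, partitionStep θ e n y =
      (√(θ * n))⁻¹ ^ e * ∑ v ∈ antitoneCompositions n (e + 1), partitionWeight θ (e + 1) n v := by
  unfold partitionStep
  rw [MeasureTheory.integral_finsetSum, Finset.mul_sum]
  · refine Finset.sum_congr rfl fun v _ => ?_
    rw [MeasureTheory.integral_indicator_const _ measurableSet_partitionCell,
      MeasureTheory.measureReal_def, volume_partitionCell,
      ENNReal.toReal_ofReal (by positivity), smul_eq_mul]
  · intro v _
    rw [MeasureTheory.integrable_indicator_iff measurableSet_partitionCell]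
    exact MeasureTheory.integrableOn_const (by rw [volume_partitionCell]; exact ENNReal.ofReal_ne_top)

theorem measurable_partitionStep (θ : ℝ) (e n : ℕ) : Measurable (partitionStep θ e n) :=
  Finset.measurable_sum _ fun _ _ => measurable_const.indicator measurableSet_partitionCell

theorem mem_partitionCell_iff (hr : 0 < √(θ * n)) : y ∈ partitionCell θ n v ↔
    ∀ i, (v i.castSucc : ℝ) ≤ n / ((e + 1 : ℕ) : ℝ) + √(θ * n) * y i ∧
      n / ((e + 1 : ℕ) : ℝ) + √(θ * n) * y i < v i.castSucc + 1 := by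
  simp only [partitionCell, Set.mem_pi, Set.mem_univ, true_imp_iff, Set.mem_Ico, div_le_iff₀ hr,
    lt_div_iff₀ hr]
  refine forall_congr' fun i => and_congr ?_ ?_ <;> constructor <;> intro h <;> linarith

/-- A cell determines all entries but the last, and the sum n determines that one. -/
theorem eq_of_mem_partitionCell (hr : 0 < √(θ * n)) (hv : v ∈ antitoneCompositions n (e + 1))
    (hw : w ∈ antitoneCompositions n (e + 1)) (hyv : y ∈ partitionCell θ n v)
    (hyw : y ∈ partitionCell θ n w) : v = w := by
  rw [mem_partitionCell_iff hr] at hyv hyw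
  rw [mem_antitoneCompositions] at hv hw
  have h : ∀ i : Fin e, v i.castSucc = w i.castSucc := by
    intro i
    have h1 : (v i.castSucc : ℝ) < w i.castSucc + 1 := (hyv i).1.trans_lt (hyw i).2
    have h2 : (w i.castSucc : ℝ) < v i.castSucc + 1 := (hyw i).1.trans_lt (hyv i).2
    have h3 : v i.castSucc < w i.castSucc + 1 := by exact_mod_cast h1
    have h4 : w i.castSucc < v i.castSucc + 1 := by exact_mod_cast h2
    omega
  have hs := hv.1.trans hw.1.symm
  rw [Fin.sum_univ_castSucc, Fin.sum_univ_castSucc, Finset.sum_congr rfl fun i _ => h i] at hs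
  funext i
  induction i using Fin.lastCases with
  | last => omega
  | cast i => exact h i

theorem partitionStep_eq_of_mem (hr : 0 < √(θ * n)) (hv : v ∈ antitoneCompositions n (e + 1))
    (hy : y ∈ partitionCell θ n v) : partitionStep θ e n y = partitionWeight θ (e + 1) n v := by
  unfold partitionStep
  rw [Finset.sum_eq_single v, Set.indicator_of_mem hy]
  · intro w hw hne
    exact Set.indicator_of_notMem (fun h => hne (eq_of_mem_partitionCell hr hw hv h hy)) _
  · exact fun h => absurd hv h

theorem partitionStep_eq_zero (h : ∀ v ∈ antitoneCompositions n (e + 1), y ∉ partitionCell θ n v) :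
    partitionStep θ e n y = 0 :=
  Finset.sum_eq_zero fun v hv => Set.indicator_of_notMem (h v hv) _

/-- The first e coordinates are off by at most 1/r. The last is minus the sum of the others on both
sides, hence off by at most e/r. -/
theorem abs_sub_tracelessExtend_le (hr : 0 < √(θ * n)) (hv : v ∈ antitoneCompositions n (e + 1))
    (hy : y ∈ partitionCell θ n v) (i : Fin (e + 1)) :
    |((v i : ℝ) - n / ((e + 1 : ℕ) : ℝ)) / √(θ * n) - tracelessExtend (e + 1) y i| ≤
      ((e + 1 : ℕ) : ℝ) / √(θ * n) := by
  rw [mem_partitionCell_iff hr] at hy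
  rw [mem_antitoneCompositions] at hv
  set r := √(θ * n) with hrdef
  set ξ : Fin (e + 1) → ℝ := fun i => ((v i : ℝ) - n / ((e + 1 : ℕ) : ℝ)) / r with hξ
  have hξsum : ∑ i, ξ i = 0 := by
    have h1 : ∑ i, (v i : ℝ) = n := by exact_mod_cast hv.1
    have h2 : ((e + 1 : ℕ) : ℝ) ≠ 0 := by positivity
    rw [hξ, ← Finset.sum_div, Finset.sum_sub_distrib, h1, Finset.sum_const, Finset.card_univ,
      Fintype.card_fin, nsmul_eq_mul, mul_div_cancel₀ _ h2, sub_self, zero_div]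
  have hcast : ∀ i : Fin e, |ξ i.castSucc - y i| ≤ 1 / r := by
    intro i
    obtain ⟨h1, h2⟩ := hy i
    have e1 : ξ i.castSucc - y i = ((v i.castSucc : ℝ) - n / ((e + 1 : ℕ) : ℝ) - r * y i) / r := by
      rw [hξ]; field_simp
    rw [e1, abs_div, abs_of_pos hr]
    gcongr
    rw [abs_le]
    constructor <;> linarith
  change |ξ i - _| ≤ _
  induction i using Fin.lastCases with
  | last =>
    rw [Fin.sum_univ_castSucc] at hξsum
    have e1 : ξ (Fin.last e) - tracelessExtend (e + 1) y (Fin.last e) =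
        -∑ i : Fin e, (ξ i.castSucc - y i) := by
      rw [tracelessExtend_last, Finset.sum_sub_distrib]
      linarith
    rw [e1, abs_neg]
    calc |∑ i : Fin e, (ξ i.castSucc - y i)| ≤ ∑ i : Fin e, |ξ i.castSucc - y i| :=
          Finset.abs_sum_le_sum_abs _ _
      _ ≤ ∑ _i : Fin e, 1 / r := Finset.sum_le_sum fun i _ => hcast i
      _ = e / r := by simp [div_eq_mul_inv]
      _ ≤ _ := by gcongr; simp
  | cast i =>
    rw [tracelessExtend_castSucc]
    refine (hcast i).trans ?_
    gcongr
    simp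

end Cells

/-! ### Dominated convergence and positivity of the limit. -/

section Limit

variable {θ : ℝ} {e : ℕ}

theorem tendsto_sqrt_mul_natCast (hθ : 0 < θ) :
    Filter.Tendsto (fun n : ℕ => √(θ * n)) Filter.atTop Filter.atTop :=
  Real.tendsto_sqrt_atTop.comp (tendsto_natCast_atTop_atTop.const_mul_atTop hθ)

/-- The limit of the step functions, up to a constant: the integrand of `regevIntegral`. -/
noncomputable def regevIntegrand (d : ℕ) (β : ℝ) (x : Fin d → ℝ) : ℝ :=
  Real.exp (-((d : ℝ) * β / 2) * ∑ i, x i ^ 2) *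
    ∏ i : Fin d, ∏ j ∈ Finset.Ioi i, (x i - x j) ^ β

theorem exists_approximating_partitions (hθ : 0 < θ) {y : Fin e → ℝ}
    (hy : StrictAnti (tracelessExtend (e + 1) y)) :
    ∃ v : ℕ → Fin (e + 1) → ℕ, (∀ᶠ n in Filter.atTop,
      v n ∈ antitoneCompositions n (e + 1) ∧ y ∈ partitionCell θ n (v n)) ∧
      ∀ i, Filter.Tendsto (fun n : ℕ => ((v n i : ℝ) - n / ((e + 1 : ℕ) : ℝ)) / √(θ * n))
        Filter.atTop (nhds (tracelessExtend (e + 1) y i)) := by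
  set D : ℝ := ((e + 1 : ℕ) : ℝ) with hD
  have hD0 : 0 < D := by positivity
  have hr := tendsto_sqrt_mul_natCast hθ
  -- The floor puts y in the cell, and the sum forces the last entry. Working in ℤ avoids
  -- truncation; nonnegativity holds eventually because n/D outgrows √(θn), and order because the
  -- limits are strictly ordered.
  set u : ℕ → Fin e → ℤ := fun n i => ⌊(n : ℝ) / D + √(θ * n) * y i⌋ with hu
  set w : ℕ → Fin (e + 1) → ℤ := fun n =>
    Fin.snoc (α := fun _ => ℤ) (u n) ((n : ℤ) - ∑ i, u n i) with hw
  have hwc : ∀ n (i : Fin e), w n i.castSucc = u n i := fun n i => by simp [hw]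
  have hwl : ∀ n, w n (Fin.last e) = (n : ℤ) - ∑ i, u n i := fun n => by simp [hw]
  have hwsum : ∀ n, ∑ i, w n i = n := fun n => by
    rw [Fin.sum_univ_castSucc, hwl, Finset.sum_congr rfl fun i _ => hwc n i]
    ring
  have hlim : ∀ i, Filter.Tendsto (fun n : ℕ => ((w n i : ℝ) - n / D) / √(θ * n))
      Filter.atTop (nhds (tracelessExtend (e + 1) y i)) := by
    have hc : ∀ i : Fin e, Filter.Tendsto (fun n : ℕ => ((u n i : ℝ) - n / D) / √(θ * n))
        Filter.atTop (nhds (y i)) := by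
      intro i
      rw [tendsto_iff_norm_sub_tendsto_zero]
      refine squeeze_zero' (Filter.Eventually.of_forall fun n => norm_nonneg _) ?_
        (tendsto_inv_atTop_zero.comp hr)
      filter_upwards [hr.eventually_gt_atTop 0] with n hn
      have h1 := Int.floor_le ((n : ℝ) / D + √(θ * n) * y i)
      have h2 := Int.lt_floor_add_one ((n : ℝ) / D + √(θ * n) * y i)
      have e1 : ((u n i : ℝ) - n / D) / √(θ * n) - y i =
          ((u n i : ℝ) - n / D - √(θ * n) * y i) / √(θ * n) := by
        rw [sub_div _ (√(θ * n) * y i), mul_div_cancel_left₀ _ hn.ne']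
      rw [Function.comp_apply, Real.norm_eq_abs, e1, abs_div, abs_of_pos hn, ← one_div]
      gcongr
      rw [abs_le]
      constructor <;> linarith
    intro i
    induction i using Fin.lastCases with
    | cast i => simpa only [hwc, tracelessExtend_castSucc] using hc i
    | last =>
      rw [tracelessExtend_last]
      refine (tendsto_finsetSum Finset.univ fun i _ => hc i).neg.congr fun n => ?_
      rw [hwl, ← Finset.sum_div, ← neg_div, Finset.sum_sub_distrib, Finset.sum_const,
        Finset.card_univ, Fintype.card_fin, nsmul_eq_mul]
      congr 1
      have : (e : ℝ) * (n / D) = n - n / D := by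
        rw [hD]; push_cast; field_simp; ring
      push_cast
      rw [this]
      ring
  have hnonneg : ∀ᶠ n in Filter.atTop, ∀ i, 0 ≤ w n i := by
    rw [Filter.eventually_all]
    intro i
    have h1 : Filter.Tendsto (fun n : ℕ => (n : ℝ) / D / √(θ * n)) Filter.atTop Filter.atTop := by
      have h2 := hr.const_mul_atTop (show 0 < 1 / (D * θ) by positivity)
      refine h2.congr' ?_
      filter_upwards [hr.eventually_gt_atTop 0] with n hn
      have h3 : √(θ * n) * √(θ * n) = θ * n := Real.mul_self_sqrt (by positivity)
      rw [eq_div_iff hn.ne', mul_assoc, h3]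
      field_simp
    filter_upwards [((hlim i).add_atTop h1).eventually_gt_atTop 0, hr.eventually_gt_atTop 0]
      with n hn hn0
    rw [← add_div, sub_add_cancel, div_pos_iff_of_pos_right hn0] at hn
    exact_mod_cast hn.le
  have hanti : ∀ᶠ n in Filter.atTop, ∀ i j, i < j → w n j ≤ w n i := by
    simp only [Filter.eventually_all]
    intro i j hij
    filter_upwards [(hlim j).eventually_lt (hlim i) (hy hij), hr.eventually_gt_atTop 0]
      with n hn hn0
    rw [div_lt_div_iff_of_pos_right hn0, sub_lt_sub_iff_right] at hn
    exact_mod_cast hn.le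
  refine ⟨fun n i => (w n i).toNat, ?_, fun i => (hlim i).congr' ?_⟩
  · filter_upwards [hnonneg, hanti, hr.eventually_gt_atTop 0] with n hn0 hna hr0
    rw [mem_antitoneCompositions, mem_partitionCell_iff hr0]
    refine ⟨⟨?_, ?_⟩, fun i => ?_⟩
    · zify
      rw [← hwsum n]
      exact Finset.sum_congr rfl fun i _ => Int.toNat_of_nonneg (hn0 i)
    · intro i j hij
      rcases hij.lt_or_eq with h | rfl
      · exact Int.toNat_le_toNat (hna i j h)
      · exact le_rfl
    · have h1 : (((w n i.castSucc).toNat : ℕ) : ℝ) = (u n i : ℝ) := by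
        rw [← hwc]
        exact_mod_cast Int.toNat_of_nonneg (hn0 i.castSucc)
      rw [h1]
      exact ⟨Int.floor_le _, Int.lt_floor_add_one _⟩
  · filter_upwards [hnonneg] with n hn0
    have h1 : (((w n i).toNat : ℕ) : ℝ) = (w n i : ℝ) := by
      exact_mod_cast Int.toNat_of_nonneg (hn0 i)
    rw [h1]

theorem mem_setOf_tracelessChamber {y : Fin e → ℝ} :
    y ∈ {y : Fin e → ℝ | tracelessExtend (e + 1) y ∈ tracelessChamber (e + 1)} ↔
      Antitone (tracelessExtend (e + 1) y) :=
  tracelessExtend_mem_tracelessChamber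

/-- In the chamber, injectivity makes the order strict and the cells containing y are followed.
Outside it some pair is out of order by a fixed gap, which the shrinking cell error cannot bridge,
so the step function eventually vanishes at y. -/
theorem tendsto_partitionStep (hθ : 0 < θ) {y : Fin e → ℝ}
    (hinj : Function.Injective (tracelessExtend (e + 1) y)) :
    Filter.Tendsto (fun n => partitionStep θ e n y) Filter.atTop
      (nhds ({y : Fin e → ℝ | tracelessExtend (e + 1) y ∈ tracelessChamber (e + 1)}.indicator
        (fun y => (2 * Real.pi)⁻¹ ^ (e + 1) *
          ((e + 1 : ℕ) : ℝ) ^ (θ * ((e + 1 : ℕ) : ℝ) ^ 2) *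
          regevIntegrand (e + 1) (2 * θ) (tracelessExtend (e + 1) y)) y)) := by
  have hr := tendsto_sqrt_mul_natCast hθ
  by_cases hy : Antitone (tracelessExtend (e + 1) y)
  · have hs : StrictAnti (tracelessExtend (e + 1) y) := hy.strictAnti_of_injective hinj
    rw [Set.indicator_of_mem (mem_setOf_tracelessChamber.2 hy)]
    obtain ⟨v, hv, hlim⟩ := exists_approximating_partitions hθ hs
    refine (tendsto_partitionWeight hθ (Nat.succ_pos e) hs
      (hv.mono fun n hn => (mem_antitoneCompositions.1 hn.1).2) hlim).congr' ?_
    filter_upwards [hv, hr.eventually_gt_atTop 0] with n hn hn0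
    exact (partitionStep_eq_of_mem hn0 hn.1 hn.2).symm
  · rw [Set.indicator_of_notMem fun h => hy (mem_setOf_tracelessChamber.1 h)]
    refine Filter.Tendsto.congr' ?_ tendsto_const_nhds
    simp only [Antitone, not_forall, not_le] at hy
    obtain ⟨i, j, hij, hlt⟩ := hy
    have hsmall : Filter.Tendsto (fun n : ℕ => ((e + 1 : ℕ) : ℝ) / √(θ * n)) Filter.atTop
        (nhds 0) := tendsto_const_nhds.div_atTop hr
    filter_upwards [hsmall.eventually_lt_const (half_pos (sub_pos.2 hlt)),
      hr.eventually_gt_atTop 0] with n hn hn0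
    refine (partitionStep_eq_zero fun v hv hyv => ?_).symm
    have h1 := abs_le.1 (abs_sub_tracelessExtend_le hn0 hv hyv i)
    have h2 := abs_le.1 (abs_sub_tracelessExtend_le hn0 hv hyv j)
    have h3 : ((v j : ℝ) - n / ((e + 1 : ℕ) : ℝ)) / √(θ * n) ≤
        ((v i : ℝ) - n / ((e + 1 : ℕ) : ℝ)) / √(θ * n) := by
      have : (v j : ℝ) ≤ v i := by exact_mod_cast (mem_antitoneCompositions.1 hv).2 hij
      gcongr
    linarith [h1.1, h1.2, h2.1, h2.2]

theorem integrable_prod_one_add_abs_rpow (e : ℕ) :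
    MeasureTheory.Integrable fun y : Fin e → ℝ => ∏ i, (1 + |y i|) ^ (-2 : ℝ) := by
  have h : MeasureTheory.Integrable fun x : ℝ => (1 + |x|) ^ (-2 : ℝ) :=
    integrable_one_add_norm (E := ℝ) (r := 2) (by simp)
  exact MeasureTheory.Integrable.fintype_prod fun _ => h

theorem exists_partitionStep_le (hθ : 0 < θ) (e : ℕ) :
    ∃ C, ∀ n, 0 < n → ∀ y : Fin e → ℝ,
      ‖partitionStep θ e n y‖ ≤ C * ∏ i, (1 + |y i|) ^ (-2 : ℝ) := by
  obtain ⟨C, hC0, hC⟩ := exists_partitionWeight_le (d := e + 1) hθ (Nat.succ_pos e)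
  have hsθ : 0 < √θ := Real.sqrt_pos.2 hθ
  -- Since |ξ - y_i| ≤ (e + 1)/√θ inside a cell, 1 + |y_i| ≤ L(1 + |ξ|), which transfers the bound
  -- from partitions to y.
  set L : ℝ := 1 + ((e + 1 : ℕ) : ℝ) / √θ with hL
  have hL0 : 0 < L := by positivity
  refine ⟨C * (L ^ (2 : ℝ)) ^ e, fun n hn y => ?_⟩
  have hn' : (1 : ℝ) ≤ n := by exact_mod_cast hn
  have hr0 : 0 < √(θ * n) := Real.sqrt_pos.2 (by positivity)
  have hrθ : √θ ≤ √(θ * n) := Real.sqrt_le_sqrt (by nlinarith)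
  have hbound0 : 0 ≤ C * (L ^ (2 : ℝ)) ^ e * ∏ i, (1 + |y i|) ^ (-2 : ℝ) := by positivity
  by_cases h : ∃ v ∈ antitoneCompositions n (e + 1), y ∈ partitionCell θ n v
  swap
  · rw [partitionStep_eq_zero fun v hv hy => h ⟨v, hv, hy⟩, norm_zero]
    exact hbound0
  obtain ⟨v, hv, hy⟩ := h
  rw [partitionStep_eq_of_mem hr0 hv hy, Real.norm_of_nonneg (partitionWeight_nonneg hθ n v)]
  refine (hC n hn v hv).trans ?_
  rw [mul_assoc]
  refine mul_le_mul_of_nonneg_left ?_ hC0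
  rw [Fin.prod_univ_castSucc]
  have hlast : (1 + |((v (Fin.last e) : ℝ) - n / ((e + 1 : ℕ) : ℝ)) / √(θ * n)|) ^ (-2 : ℝ) ≤ 1 :=
    Real.rpow_le_one_of_one_le_of_nonpos (le_add_of_nonneg_right (abs_nonneg _)) (by norm_num)
  have hcoord : ∀ i : Fin e,
      (1 + |((v i.castSucc : ℝ) - n / ((e + 1 : ℕ) : ℝ)) / √(θ * n)|) ^ (-2 : ℝ) ≤
        L ^ (2 : ℝ) * (1 + |y i|) ^ (-2 : ℝ) := by
    intro i
    have h1 := abs_sub_tracelessExtend_le hr0 hv hy i.castSucc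
    rw [tracelessExtend_castSucc] at h1
    set ξ := ((v i.castSucc : ℝ) - n / ((e + 1 : ℕ) : ℝ)) / √(θ * n)
    have h2 : ((e + 1 : ℕ) : ℝ) / √(θ * n) ≤ ((e + 1 : ℕ) : ℝ) / √θ := by gcongr
    have h3 : |y i| ≤ |ξ| + |ξ - y i| := by
      have := abs_sub_abs_le_abs_sub (y i) ξ
      rw [abs_sub_comm] at this
      linarith
    have hξ0 := abs_nonneg ξ
    have hy0 := abs_nonneg (y i)
    have h4 : 1 + |y i| ≤ L * (1 + |ξ|) := by
      have h5 : 0 ≤ ((e + 1 : ℕ) : ℝ) / √θ := by positivity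
      rw [hL]
      nlinarith [mul_nonneg h5 hξ0]
    have h6 : (L * (1 + |ξ|)) ^ (-2 : ℝ) ≤ (1 + |y i|) ^ (-2 : ℝ) :=
      Real.rpow_le_rpow_of_nonpos (by positivity) h4 (by norm_num)
    rw [Real.mul_rpow hL0.le (by positivity), Real.rpow_neg hL0.le] at h6
    have h7 : 0 < L ^ (2 : ℝ) := by positivity
    rwa [inv_mul_le_iff₀ h7] at h6
  calc _ ≤ (∏ i : Fin e, L ^ (2 : ℝ) * (1 + |y i|) ^ (-2 : ℝ)) * 1 := by
        refine mul_le_mul (Finset.prod_le_prod (fun i _ => by positivity) fun i _ => hcoord i)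
          hlast (by positivity) (Finset.prod_nonneg fun i _ => by positivity)
    _ = _ := by rw [mul_one, Finset.prod_mul_distrib, Fin.prod_const]

theorem regevIntegral_eq_integral_regevIntegrand (e : ℕ) (β : ℝ) :
    regevIntegral (e + 1) β =
      ∫ y in {y : Fin e → ℝ | tracelessExtend (e + 1) y ∈ tracelessChamber (e + 1)},
        regevIntegrand (e + 1) β (tracelessExtend (e + 1) y) := rfl

theorem tendsto_sum_partitionWeight (hθ : 0 < θ) (e : ℕ) :
    Filter.Tendsto (fun n : ℕ => (√(θ * n))⁻¹ ^ e *
      ∑ v ∈ antitoneCompositions n (e + 1), partitionWeight θ (e + 1) n v) Filter.atTop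
      (nhds ((2 * Real.pi)⁻¹ ^ (e + 1) * ((e + 1 : ℕ) : ℝ) ^ (θ * ((e + 1 : ℕ) : ℝ) ^ 2) *
        regevIntegral (e + 1) (2 * θ))) := by
  obtain ⟨C, hC⟩ := exists_partitionStep_le hθ e
  rw [regevIntegral_eq_integral_regevIntegrand, ← MeasureTheory.integral_const_mul,
    ← MeasureTheory.integral_indicator measurableSet_tracelessChamber_preimage]
  simp only [← integral_partitionStep]
  refine MeasureTheory.tendsto_integral_filter_of_dominated_convergence
    (fun y => C * ∏ i, (1 + |y i|) ^ (-2 : ℝ))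
    (Filter.Eventually.of_forall fun n => (measurable_partitionStep θ e n).aestronglyMeasurable)
    ?_ ((integrable_prod_one_add_abs_rpow e).const_mul C) ?_
  · filter_upwards [Filter.eventually_gt_atTop 0] with n hn
    exact Filter.Eventually.of_forall (hC n hn)
  · filter_upwards [ae_tracelessExtend_injective] with y hy
    exact tendsto_partitionStep hθ hy

theorem regevIntegrand_nonneg {d : ℕ} {β : ℝ} {x : Fin d → ℝ} (hx : Antitone x) :
    0 ≤ regevIntegrand d β x :=
  mul_nonneg (Real.exp_pos _).le (Finset.prod_nonneg fun _ _ => Finset.prod_nonneg fun _ hj =>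
    Real.rpow_nonneg (sub_nonneg.2 (hx (Finset.mem_Ioi.1 hj).le)) _)

theorem regevIntegrand_pos {d : ℕ} {β : ℝ} {x : Fin d → ℝ} (hx : StrictAnti x) :
    0 < regevIntegrand d β x :=
  mul_pos (Real.exp_pos _) (Finset.prod_pos fun _ _ => Finset.prod_pos fun _ hj =>
    Real.rpow_pos_of_pos (sub_pos.2 (hx (Finset.mem_Ioi.1 hj))) _)

/-- Integrability is inherited from the step functions through their almost everywhere limit and
common majorant; the integrand is positive on a nonempty open set. -/
theorem regevIntegral_pos (hθ : 0 < θ) (e : ℕ) : 0 < regevIntegral (e + 1) (2 * θ) := by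
  set κ : ℝ := (2 * Real.pi)⁻¹ ^ (e + 1) * ((e + 1 : ℕ) : ℝ) ^ (θ * ((e + 1 : ℕ) : ℝ) ^ 2) with hκ
  have hκ0 : 0 < κ := by positivity
  set S : Set (Fin e → ℝ) := {y | tracelessExtend (e + 1) y ∈ tracelessChamber (e + 1)} with hS
  set f : (Fin e → ℝ) → ℝ := S.indicator fun y =>
    κ * regevIntegrand (e + 1) (2 * θ) (tracelessExtend (e + 1) y) with hf
  obtain ⟨C, hC⟩ := exists_partitionStep_le hθ e
  have hlim : ∀ᵐ y : Fin e → ℝ, Filter.Tendsto (fun n => partitionStep θ e n y) Filter.atTop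
      (nhds (f y)) := by
    filter_upwards [ae_tracelessExtend_injective] with y hy
    exact tendsto_partitionStep hθ hy
  have hint : MeasureTheory.Integrable f := by
    refine ((integrable_prod_one_add_abs_rpow e).const_mul C).mono'
      (aestronglyMeasurable_of_tendsto_ae Filter.atTop
        (fun n => (measurable_partitionStep θ e n).aestronglyMeasurable) hlim) ?_
    filter_upwards [hlim] with y hy
    refine le_of_tendsto hy.norm ?_
    filter_upwards [Filter.eventually_gt_atTop 0] with n hn
    exact hC n hn y
  have hf0 : 0 ≤ f := fun y => Set.indicator_nonneg (fun y hy => mul_nonneg hκ0.le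
    (regevIntegrand_nonneg (mem_setOf_tracelessChamber.1 hy))) y
  have hpos : 0 < ∫ y, f y := by
    rw [MeasureTheory.integral_pos_iff_support_of_nonneg hf0 hint]
    refine lt_of_lt_of_le (isOpen_strictAnti_tracelessExtend.measure_pos MeasureTheory.volume
      (exists_strictAnti_tracelessExtend e)) (MeasureTheory.measure_mono fun y hy => ?_)
    rw [Function.mem_support, hf, hS, Set.indicator_of_mem
      (mem_setOf_tracelessChamber.2 (StrictAnti.antitone hy))]
    exact (mul_pos hκ0 (regevIntegrand_pos hy)).ne'
  rw [hf, MeasureTheory.integral_indicator measurableSet_tracelessChamber_preimage,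
    MeasureTheory.integral_const_mul, ← regevIntegral_eq_integral_regevIntegrand] at hpos
  exact (mul_pos_iff_of_pos_left hκ0).1 hpos

end Limit

/-! ### Assembly of the constants. -/

/-- Stirling's formula for n!, as the local limit theorem at the centre x = 0. -/
theorem tendsto_poissonWeight_self :
    Filter.Tendsto (fun n => poissonWeight 1 n n) Filter.atTop (nhds (√(1 / (2 * Real.pi)))) := by
  have h := (tendsto_poissonWeight (d := 1) (θ := 1) (x := 0) one_pos one_pos (k := id)
    (by simp)).2
  simpa using h

theorem mainTheorem4 (d : ℕ) (hd : 1 ≤ d) (α : ℝ) (hα : 0 < α) :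
    Asymptotics.IsEquivalent Filter.atTop
      (fun n : ℕ => ∑ μ ∈ partitionsOfLengthLE n d,
        ((n.factorial : ℝ) / jackHookLower α μ) * ((n.factorial : ℝ) / jackHookUpper α μ))
      (fun n : ℕ =>
        (Real.Gamma (1 / α) ^ d * (d : ℝ) ^ (2 * (n : ℝ) + (d : ℝ) ^ 2 / α)) /
          ((2 * Real.pi) ^ (d - 1) *
            α ^ (2 * (n : ℝ) + ((d : ℝ) ^ 2 - d) / (2 * α) + ((d : ℝ) - 1) / 2) *
            (n : ℝ) ^ (((d : ℝ) ^ 2 + d) / (2 * α) - ((d : ℝ) + 1) / 2)) *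
          regevIntegral d (2 / α)) := by
  obtain ⟨e, rfl⟩ : ∃ e, d = e + 1 := ⟨d - 1, by omega⟩
  set D : ℝ := ((e + 1 : ℕ) : ℝ) with hD
  have hD0 : 0 < D := by positivity
  have hDe : (e : ℝ) = D - 1 := by rw [hD]; push_cast; ring
  have hθ : 0 < 1 / α := by positivity
  have hβ : 2 / α = 2 * (1 / α) := by ring
  have hZ := regevIntegral_pos hθ e
  rw [← hβ] at hZ
  set Z := regevIntegral (e + 1) (2 / α) with hZdef
  set κ : ℝ := (2 * Real.pi)⁻¹ ^ (e + 1) * D ^ (1 / α * D ^ 2) with hκ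
  have hκ0 : 0 < κ := by positivity
  have hs : √(1 / (2 * Real.pi)) ≠ 0 := (Real.sqrt_pos.2 (by positivity)).ne'
  have hlim := ((tendsto_poissonWeight_self.inv₀ hs).pow 2).mul (tendsto_sum_partitionWeight hθ e)
  rw [← hβ, inv_pow, Real.sq_sqrt (by positivity), one_div (2 * Real.pi), inv_inv, ← hκ, ← hZdef] at hlim
  have hlim2 := hlim.div_const (2 * Real.pi * (κ * Z))
  rw [div_self (by positivity)] at hlim2
  refine Asymptotics.isEquivalent_of_tendsto_one (hlim2.congr' ?_)
  filter_upwards [Filter.eventually_gt_atTop 0] with n hn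
  have hn' : (0 : ℝ) < n := by exact_mod_cast hn
  have hG : 0 < Real.Gamma (1 / α) := Real.Gamma_pos_of_pos hθ
  have hsum := sum_partitionsOfLengthLE (n := n) (d := e + 1) (fun μ =>
    ((n.factorial : ℝ) / jackHookLower α μ) * ((n.factorial : ℝ) / jackHookUpper α μ))
    (fun v => (α⁻¹ ^ (2 * n) * Real.Gamma (1 / α) ^ (e + 1) * (poissonWeight 1 n n)⁻¹ ^ 2 *
        (n : ℝ) ^ (1 - 1 / α * D ^ 2) * D ^ (2 * n) *
        √(1 / α * n) ^ (2 * (1 / α) * (D * (D - 1) / 2))) * partitionWeight (1 / α) (e + 1) n v)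
    fun μ hμ => summand_eq_partitionWeight (d := e + 1) hd hα hn hμ
  rw [← Finset.mul_sum] at hsum
  rw [Pi.div_apply, hsum]
  set W := ∑ v ∈ antitoneCompositions n (e + 1), partitionWeight (1 / α) (e + 1) n v
  set p := (poissonWeight 1 n n)⁻¹ ^ 2 with hp
  set r := √(1 / α * n) with hr
  have hr0 : 0 < r := Real.sqrt_pos.2 (by positivity)
  set a : ℝ := (D ^ 2 - D) / (2 * α) + (D - 1) / 2 with ha
  set q : ℝ := (D ^ 2 + D) / (2 * α) - (D + 1) / 2 with hq
  -- The first power comes from normalizing the differences, r^e from the volume of a cell; together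
  -- they produce the powers of α and n.
  have hrpow : r ^ (2 * (1 / α) * (D * (D - 1) / 2)) * r ^ e = (α ^ a)⁻¹ * (n : ℝ) ^ a := by
    rw [← Real.rpow_natCast r e, ← Real.rpow_add hr0, hDe, hr, Real.sqrt_eq_rpow,
      ← Real.rpow_mul (by positivity), Real.mul_rpow hθ.le hn'.le, one_div,
      Real.inv_rpow hα.le]
    have : 1 / 2 * (2 * α⁻¹ * (D * (D - 1) / 2) + (D - 1)) = a := by
      rw [ha]; field_simp
    rw [this]
  have hnpow : (n : ℝ) ^ (1 - 1 / α * D ^ 2) * (n : ℝ) ^ a = ((n : ℝ) ^ q)⁻¹ := by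
    rw [← Real.rpow_neg hn'.le, ← Real.rpow_add hn']
    congr 1
    rw [ha, hq]
    field_simp
    ring
  have h2n : ∀ x : ℝ, x ^ (2 * (n : ℝ)) = x ^ (2 * n) := fun x => by
    rw [← Real.rpow_natCast x (2 * n), Nat.cast_mul, Nat.cast_ofNat]
  have hαpow : α ^ (2 * (n : ℝ) + (D ^ 2 - D) / (2 * α) + (D - 1) / 2) = α ^ (2 * n) * α ^ a := by
    rw [add_assoc, Real.rpow_add hα, h2n]
  have hDpow : D ^ (2 * (n : ℝ) + D ^ 2 / α) = D ^ (2 * n) * D ^ (1 / α * D ^ 2) := by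
    rw [Real.rpow_add hD0, h2n, one_div_mul_eq_div]
  have hαa : 0 < α ^ a := by positivity
  have hnq : 0 < (n : ℝ) ^ q := by positivity
  -- The claimed right side in the shape of the factored sum. The 2π from n!² turns (2π)^(-(e+1)) in
  -- κ into (2π)^(-e).
  have hright : Real.Gamma (1 / α) ^ (e + 1) * D ^ (2 * (n : ℝ) + D ^ 2 / α) /
      ((2 * Real.pi) ^ (e + 1 - 1) *
        α ^ (2 * (n : ℝ) + (D ^ 2 - D) / (2 * α) + (D - 1) / 2) * (n : ℝ) ^ q) * Z =
      (α⁻¹ ^ (2 * n) * Real.Gamma (1 / α) ^ (e + 1) * (n : ℝ) ^ (1 - 1 / α * D ^ 2) * D ^ (2 * n) *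
        r ^ (2 * (1 / α) * (D * (D - 1) / 2))) * r ^ e * (2 * Real.pi * (κ * Z)) := by
    calc _ = α⁻¹ ^ (2 * n) * Real.Gamma (1 / α) ^ (e + 1) * D ^ (2 * n) *
          ((n : ℝ) ^ (1 - 1 / α * D ^ 2) * ((α ^ a)⁻¹ * (n : ℝ) ^ a)) *
          (2 * Real.pi * (κ * Z)) := by
          rw [mul_left_comm _ (α ^ a)⁻¹, hnpow, hαpow, hDpow, hκ, Nat.add_sub_cancel, inv_pow,
            inv_pow, pow_succ (2 * Real.pi)]
          have := Real.pi_pos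
          field_simp
      _ = _ := by rw [← hrpow]; ring
  rw [hright]
  have h1 : (0 : ℝ) < (n : ℝ) ^ (1 - 1 / α * D ^ 2) := by positivity
  have h2 : (0 : ℝ) < r ^ (2 * (1 / α) * (D * (D - 1) / 2)) := by positivity
  have h3 : 0 < Real.Gamma (1 / α) ^ (e + 1) := by positivity
  have h4 : (0 : ℝ) < α⁻¹ ^ (2 * n) := by positivity
  have h5 : 0 < D ^ (2 * n) := by positivity
  have h6 : 0 < r ^ e := by positivity
  have h7 : 0 < 2 * Real.pi * (κ * Z) := by positivity
  rw [inv_pow r e]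
  generalize α⁻¹ ^ (2 * n) = x1 at *
  generalize Real.Gamma (1 / α) ^ (e + 1) = x2 at *
  generalize (n : ℝ) ^ (1 - 1 / α * D ^ 2) = x3 at *
  generalize D ^ (2 * n) = x4 at *
  generalize r ^ (2 * (1 / α) * (D * (D - 1) / 2)) = x5 at *
  generalize r ^ e = x6 at *
  generalize 2 * Real.pi * (κ * Z) = x7 at *
  field_simp
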